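/- A non-commutative probability space $(\mathcal A,\varphi)$ is a unital complex algebra $\mathcal A$ with a linear functional $\varphi$ such that $\varphi(1)=1$; it is a $*$-probability space if moreover $\mathcal A$ is a complex $*$-algebra and $\varphi(x^*x)\ge 0$ for all $x$. The free cumulants $\kappa_n$ ($n\ge 1$) are the functionals determined by $\varphi(x_1\cdots x_n)=\sum_{\pi\in NC(n)}\prod_{V\in\pi}\kappa_{|V|}(x_V)$, where $NC(n)$ is the set of non-crossing partitions of $\{1,\dots,n\}$ and $x_V$ is the list of the $x_i$, $i\in V$, in increasing order of $i$. Let $a$ be a random variable, i.e. an element of some non-commutative probability space. For $N\ge 1$, a quantum random matrix of size $N$ associated with $a$ is a matrix $A=(a_{ij})_{i,j=1}^N$ with entries in some non-commutative probability space (not necessarily that of $a$) such that, for all $n\ge1$, $$\kappa_n(a_{i(1)i(2)},a_{i(2)i(3)},\dots,a_{i(n)i(1)})=N^{1-n}\,\kappa_n(a,\dots,a)\qquad\text{for all } i(1),\dots,i(n)\in\{1,\dots,N\},$$ and all other free cumulants of the entries vanish, i.e. $\kappa_n(a_{i(1)j(1)},\dots,a_{i(n)j(n)})=0$ unless $j(1)=i(2),\dots,j(n-1)=i(n),\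 j(n)=i(1)$. Let $\mathrm{Tr}$ be the non-normalized trace. Then: 1. For every $a$ and every $N\ge1$ such a matrix $A$ exists. 2. For every $a$, every $N\ge 1$, every such $A$, every $n\ge1$ and all $k(1),\dots,k(n)\ge1$, $$\kappa_n\bigl(\mathrm{Tr}(A^{k(1)}),\dots,\mathrm{Tr}(A^{k(n)})\bigr)=N^{2-n}\,\kappa_n\bigl(a^{k(1)},\dots,a^{k(n)}\bigr).$$ 3. Let $a$ be fixed and, for each $N\ge1$, let $A_N$ be a quantum random matrix of size $N$ associated with $a$. Then for all $n\ge3$ and $k(1),\dots,k(n)\ge1$, $\kappa_n(\mathrm{Tr}(A_N^{k(1)}),\dots,\mathrm{Tr}(A_N^{k(n)}))\to0$ as $N\to\infty$. 4. For every $a$, every $N\ge1$, every such $A$ and all $p,q\ge1$, $\kappa_2(\mathrm{Tr}(A^p),\mathrm{Tr}(A^q))=\kappa_2(a^p,a^q)$. Call $a$ normalized if it is a selfadjoint element of a $*$-probability space, its moments are those of a probability measure on $\mathbb R$ with support exactly $[-2,2]$, and $\kappa_1(a)=0$, $\kappa_2(a,a)=1$. 5. The covariance depends on $a$, even among normalized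 variables: there are normalized $a,b$ and $p,q\ge1$ such that for every $N\ge1$ and all quantum random matrices $A$, $B$ of size $N$ associated with $a$ and $b$ respectively, $\kappa_2(\mathrm{Tr}(A^p),\mathrm{Tr}(A^q))\neq\kappa_2(\mathrm{Tr}(B^p),\mathrm{Tr}(B^q))$. 6. The fluctuations are not universal: there is no array $(C_{p,q})_{p,q\ge1}$ of complex numbers such that for every normalized $a$, every choice of quantum random matrices $A_N$ of size $N$ ($N\ge1$) associated with $a$, and all $p,q\ge1$, $\kappa_2(\mathrm{Tr}(A_N^p),\mathrm{Tr}(A_N^q))\to C_{p,q}$ as $N\to\infty$. -/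

import Mathlib

open Filter Topology MeasureTheory

universe u v

namespace QuantumRandomMatrix

/-- A non-commutative probability space `(𝒜, φ)`: a unital complex algebra with a unital
linear functional. -/
structure NCProbSpace : Type (u + 1) where
  carrier : Type u
  [ring : Ring carrier]
  [algebra : Algebra ℂ carrier]
  φ : carrier →ₗ[ℂ] ℂ
  map_one : φ 1 = 1

attribute [instance] NCProbSpace.ring NCProbSpace.algebra

/-- A `*`-probability space: a non-commutative probability space whose algebra is a complex
`*`-algebra and whose functional is positive. -/
structure StarProbSpace : Type (u + 1) extends NCProbSpace.{u} where
  [starRing : StarRing carrier]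
  [starModule : StarModule ℂ carrier]
  positive : ∀ x : carrier, 0 ≤ (φ (star x * x)).re ∧ (φ (star x * x)).im = 0

attribute [instance] StarProbSpace.starRing StarProbSpace.starModule

/-- A partition of `{0, …, n-1}` is non-crossing if there are no `i < j < k < l` with `i, k` in
one block and `j, l` in another block. -/
def IsNonCrossing {n : ℕ} (π : Finpartition (Finset.univ : Finset (Fin n))) : Prop :=
  ∀ V ∈ π.parts, ∀ W ∈ π.parts, V ≠ W →
    ∀ i j k l : Fin n, i < j → j < k → k < l → i ∈ V → k ∈ V → j ∈ W → l ∈ W → False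

open scoped Classical in
/-- The set `NC(n)` of non-crossing partitions. -/
noncomputable def NC (n : ℕ) : Finset (Finpartition (Finset.univ : Finset (Fin n))) :=
  Finset.univ.filter IsNonCrossing

open scoped Classical in
/-- The non-crossing partitions of `{0, …, n-1}` other than the one-block partition. -/
noncomputable def properNC (n : ℕ) : Finset (Finpartition (Finset.univ : Finset (Fin n))) :=
  (NC n).filter fun π => Finset.univ ∉ π.parts

theorem card_lt_of_mem_properNC {n : ℕ} {π : Finpartition (Finset.univ : Finset (Fin n))}
    (hπ : π ∈ properNC n) {V : Finset (Fin n)} (hV : V ∈ π.parts) : V.card < n := by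
  have h : Finset.univ ∉ π.parts := (Finset.mem_filter.mp hπ).2
  have hne : V ≠ Finset.univ := fun e => h (e ▸ hV)
  simpa using Finset.card_lt_univ_of_notMem
    (Classical.not_forall.mp (fun hall => hne (Finset.eq_univ_of_forall hall))).choose_spec

/-- The `n`-th free cumulant `κ_n(x 0, …, x (n-1))`, defined recursively from the
moment-cumulant formula: the moment `φ(x 0 ⋯ x (n-1))` minus the contributions
`∏_{V ∈ π} κ_{|V|}(x|_V)` of all non-crossing partitions with more than one block.
See `moment_eq_sum_freeCumulant`. By convention `κ_0 = 0`. -/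
noncomputable def freeCumulant (P : NCProbSpace.{u}) (n : ℕ) (x : Fin n → P.carrier) : ℂ :=
  P.φ (List.ofFn x).prod -
    ∑ π : {π // π ∈ properNC n}, ∏ V : {V // V ∈ π.1.parts},
      freeCumulant P V.1.card (fun t => x (V.1.orderEmbOfFin rfl t))
termination_by n
decreasing_by exact card_lt_of_mem_properNC π.2 V.2

theorem freeCumulant_zero (P : NCProbSpace.{u}) (x : Fin 0 → P.carrier) :
    freeCumulant P 0 x = 0 := by
  rw [freeCumulant]
  have hp : ∀ π : Finpartition (Finset.univ : Finset (Fin 0)), π.parts = ∅ := fun π =>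
    π.parts_eq_empty_iff.mpr (by simp)
  have hmem : ∀ π, π ∈ properNC 0 := fun π => by
    simp [properNC, NC, IsNonCrossing, hp π]
  have huniq : ∀ π π' : Finpartition (Finset.univ : Finset (Fin 0)), π = π' := fun π π' =>
    Finpartition.ext ((hp π).trans (hp π').symm)
  let π₀ : {π // π ∈ properNC 0} := ⟨⟨∅, by simp, by simp, by simp⟩, hmem _⟩
  rw [Fintype.sum_eq_single π₀ (fun π h => absurd (Subtype.ext (huniq _ _)) h)]
  have : IsEmpty {V // V ∈ π₀.1.parts} := ⟨fun V =>
    Finset.notMem_empty V.1 V.2⟩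
  rw [Fintype.prod_empty]
  simp [P.map_one]

theorem freeCumulant_univ (P : NCProbSpace.{u}) (n : ℕ) (x : Fin n → P.carrier) :
    ∀ (m : ℕ) (h : (Finset.univ : Finset (Fin n)).card = m),
      freeCumulant P m (fun t => x (Finset.univ.orderEmbOfFin h t)) = freeCumulant P n x := by
  intro m h
  obtain rfl : n = m := by simpa using h
  have : (RelEmbedding.refl (· ≤ ·) : Fin n ↪o Fin n) = Finset.univ.orderEmbOfFin h :=
    Finset.orderEmbOfFin_unique' h (by simp)
  rw [← this]
  rfl

/-- The moment-cumulant formula `φ(x 0 ⋯ x (n-1)) = ∑_{π ∈ NC(n)} ∏_{V ∈ π} κ_{|V|}(x|_V)`. -/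
theorem moment_eq_sum_freeCumulant (P : NCProbSpace.{u}) (n : ℕ) (x : Fin n → P.carrier) :
    P.φ (List.ofFn x).prod =
      ∑ π ∈ NC n, ∏ V ∈ π.parts,
        freeCumulant P V.card (fun t => x (V.orderEmbOfFin rfl t)) := by
  have hdef : P.φ (List.ofFn x).prod = freeCumulant P n x +
      ∑ π ∈ properNC n, ∏ V ∈ π.parts,
        freeCumulant P V.card (fun t => x (V.orderEmbOfFin rfl t)) := by
    conv_rhs => rw [freeCumulant]
    rw [← Finset.sum_coe_sort (properNC n)]
    simp_rw [← Finset.prod_coe_sort (Finpartition.parts _)]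
    ring
  classical
  rw [hdef, ← Finset.sum_filter_add_sum_filter_not (NC n) (fun π => Finset.univ ∈ π.parts)]
  have hp : (NC n).filter (fun π => ¬ Finset.univ ∈ π.parts) = properNC n := by
    unfold properNC
    congr
  rw [hp]
  congr 1
  have key : ∀ π : Finpartition (Finset.univ : Finset (Fin n)), Finset.univ ∈ π.parts →
      π.parts = {Finset.univ} := by
    intro π hπ
    refine Finset.eq_singleton_iff_unique_mem.mpr ⟨hπ, fun V hV => ?_⟩
    obtain ⟨t, ht⟩ := π.nonempty_of_mem_parts hV
    exact π.eq_of_mem_parts hV hπ ht (Finset.mem_univ t)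
  rcases Nat.eq_zero_or_pos n with rfl | hn
  · rw [freeCumulant_zero, Finset.sum_eq_zero]
    intro π hπ
    exact absurd (Finset.mem_filter.mp hπ).2 (by
      rw [π.parts_eq_empty_iff.mpr (by simp)]
      simp)
  · have : NeZero n := ⟨hn.ne'⟩
    let π₀ : Finpartition (Finset.univ : Finset (Fin n)) :=
      Finpartition.indiscrete (Finset.univ_nonempty.ne_empty)
    have hπ₀ : π₀.parts = {Finset.univ} := rfl
    rw [Finset.sum_eq_single π₀]
    · rw [hπ₀, Finset.prod_singleton, freeCumulant_univ]
    · intro π hπ hne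
      exact absurd (Finpartition.ext ((key π (Finset.mem_filter.mp hπ).2).trans hπ₀.symm)) hne
    · intro h
      refine absurd (Finset.mem_filter.mpr ⟨Finset.mem_filter.mpr ⟨Finset.mem_univ _, ?_⟩, ?_⟩) h
      · intro V hV W hW hVW
        rw [hπ₀, Finset.mem_singleton] at hV hW
        exact absurd (hV.trans hW.symm) hVW
      · simp [hπ₀]

/-- `A` is the quantum `N × N` random matrix associated with the random variable `a`: the cyclic
free cumulants of its entries are `N^{1-n} κ_n(a, …, a)` and all the others vanish.
(`finRotate n` is the cyclic shift `t ↦ t + 1` of `{0, …, n-1}`.) -/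
structure IsQuantumMatrix (P : NCProbSpace.{u}) (a : P.carrier) (Q : NCProbSpace.{v}) (N : ℕ)
    (A : Matrix (Fin N) (Fin N) Q.carrier) : Prop where
  cyclic : ∀ n : ℕ, 1 ≤ n → ∀ i : Fin n → Fin N,
    freeCumulant Q n (fun t => A (i t) (i (finRotate n t))) =
      (N : ℂ) ^ ((1 : ℤ) - n) * freeCumulant P n (fun _ => a)
  noncyclic : ∀ n : ℕ, 1 ≤ n → ∀ i j : Fin n → Fin N,
    (∃ t, j t ≠ i (finRotate n t)) → freeCumulant Q n (fun t => A (i t) (j t)) = 0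

/-- `a` is a selfadjoint random variable whose distribution is a probability measure with support
`[-2, 2]`, and which has mean zero and variance one. -/
def IsNormalized (P : StarProbSpace.{u}) (a : P.carrier) : Prop :=
  IsSelfAdjoint a ∧
  (∃ μ : Measure ℝ, IsProbabilityMeasure μ ∧ μ.support = Set.Icc (-2) 2 ∧
    ∀ m : ℕ, P.φ (a ^ m) = ((∫ x, x ^ m ∂μ : ℝ) : ℂ)) ∧
  freeCumulant P.toNCProbSpace 1 ![a] = 0 ∧ freeCumulant P.toNCProbSpace 2 ![a, a] = 1

/-- Universality of the fluctuations: the limits of the covariances of traces of powers of the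
quantum random matrices exist and are the same for all normalized `a`. -/
def UniversalFluctuations : Prop :=
  ∃ C : ℕ → ℕ → ℂ, ∀ (P : StarProbSpace.{0}) (a : P.carrier), IsNormalized P a →
    ∀ (Q : ℕ → NCProbSpace.{0}) (A : ∀ N, Matrix (Fin N) (Fin N) (Q N).carrier),
      (∀ N, 1 ≤ N → IsQuantumMatrix P.toNCProbSpace a (Q N) N (A N)) →
      ∀ p q : ℕ, 1 ≤ p → 1 ≤ q →
        Tendsto (fun N => freeCumulant (Q N) 2 ![(A N ^ p).trace, (A N ^ q).trace])
          atTop (𝓝 (C p q))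

end QuantumRandomMatrix

/-! The cumulant identity for traces reduces to a statement about entries of powers
(`IsQuantumMatrix.kap_entries`): the cumulant of the entries of $A^{k(1)},\dots,A^{k(n)}$ at
positions $(i_t,j_t)$ is $N^{1-n}\kappa_n(a^{k(1)},\dots,a^{k(n)})$ if the word of positions is a
closed path, and $0$ otherwise. For exponents equal to $1$ this is the definition of a quantum
random matrix.

Higher exponents are reached by induction on $\sum_t(k(t)-1)$, writing $(A^k)_{ij}=\sum_r
A_{ir}(A^{k-1})_{rj}$ and $a^k=a\cdot a^{k-1}$. A cumulant with a product $x_px_q$ as an entry is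
the cumulant with $x_p,x_q$ as separate entries plus a sum over pairs of non-crossing blocks
separating $p$ from $q$ (`kap_update_mul`). Applied on both sides, it yields matching terms, and
only the powers of $N$ have to be compared. In the unsplit term every $r$ keeps the path closed
(`isCyc_insert`), giving $N\cdot N^{1-(n+1)}=N^{1-n}$. In a split term exactly one $r$ closes both
loops (`isCyc_splits`), giving $N^{1-|V|}N^{1-|W|}=N^{1-n}$, since $|V|+|W|=n+1$. For traces, a
closed path of diagonal positions is constant; there are $N$ of these, whence $N^{2-n}$.

The product formula itself follows from uniqueness: weights on blocks are determined by their sums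
over non-crossing partitions (`weight_eq_of_ncSum_eq`), and `ncSum_glue` gives the two candidates
the same sums. The same uniqueness shows that a free algebra can be given arbitrary prescribed
cumulants in its generators (`freeCumulant_modelGen`), hence existence. Since the covariance is
exactly $\kappa_2(a^p,a^q)$ for every $N$, two normalized variables with different fourth moments
rule out universality. -/

namespace QuantumRandomMatrix

/-! ### Weighted sums over non-crossing partitions -/

section NonCrossingSums

open scoped Classical

variable {α β : Type*} [LinearOrder α] [LinearOrder β]

/-- There are `i < j < k < l` with `i, k ∈ V` and `j, l ∈ W`. -/
def Crosses (V W : Finset α) : Prop :=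
  ∃ i j k l : α, i < j ∧ j < k ∧ k < l ∧ i ∈ V ∧ k ∈ V ∧ j ∈ W ∧ l ∈ W

/-- The finsets `V` and `W` do not cross. -/
def NonCr (V W : Finset α) : Prop := ¬ Crosses V W ∧ ¬ Crosses W V

theorem NonCr.symm {V W : Finset α} (h : NonCr V W) : NonCr W V := ⟨h.2, h.1⟩

theorem Crosses.mono {V V' W W' : Finset α} (hV : V ⊆ V') (hW : W ⊆ W') (h : Crosses V W) :
    Crosses V' W' := by
  obtain ⟨i, j, k, l, h1, h2, h3, h4, h5, h6, h7⟩ := h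
  exact ⟨i, j, k, l, h1, h2, h3, hV h4, hV h5, hW h6, hW h7⟩

theorem NonCr.mono {V V' W W' : Finset α} (hV : V ⊆ V') (hW : W ⊆ W') (h : NonCr V' W') :
    NonCr V W := ⟨fun c => h.1 (c.mono hV hW), fun c => h.2 (c.mono hW hV)⟩

theorem crosses_map (e : β ↪o α) (V W : Finset β) :
    Crosses (V.map e.toEmbedding) (W.map e.toEmbedding) ↔ Crosses V W := by
  constructor
  · rintro ⟨i, j, k, l, h1, h2, h3, h4, h5, h6, h7⟩
    simp only [Finset.mem_map, RelEmbedding.coe_toEmbedding] at h4 h5 h6 h7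
    obtain ⟨i, hi, rfl⟩ := h4
    obtain ⟨k, hk, rfl⟩ := h5
    obtain ⟨j, hj, rfl⟩ := h6
    obtain ⟨l, hl, rfl⟩ := h7
    exact ⟨i, j, k, l, e.lt_iff_lt.1 h1, e.lt_iff_lt.1 h2, e.lt_iff_lt.1 h3, hi, hk, hj, hl⟩
  · rintro ⟨i, j, k, l, h1, h2, h3, h4, h5, h6, h7⟩
    exact ⟨e i, e j, e k, e l, e.lt_iff_lt.2 h1, e.lt_iff_lt.2 h2, e.lt_iff_lt.2 h3,
      Finset.mem_map_of_mem _ h4, Finset.mem_map_of_mem _ h5, Finset.mem_map_of_mem _ h6,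
      Finset.mem_map_of_mem _ h7⟩

theorem nonCr_map (e : β ↪o α) (V W : Finset β) :
    NonCr (V.map e.toEmbedding) (W.map e.toEmbedding) ↔ NonCr V W := by
  simp only [NonCr, crosses_map]

/-- The non-crossing partitions of the finset `s`, as finsets of blocks. -/
noncomputable def ncParts (s : Finset α) : Finset (Finset (Finset α)) :=
  s.powerset.powerset.filter fun 𝒮 =>
    (∅ ∉ 𝒮 ∧ ∀ t ∈ s, ∃ V ∈ 𝒮, t ∈ V) ∧
      ∀ V ∈ 𝒮, ∀ W ∈ 𝒮, V ≠ W → Disjoint V W ∧ NonCr V W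

theorem mem_ncParts {s : Finset α} {𝒮 : Finset (Finset α)} :
    𝒮 ∈ ncParts s ↔ (∀ V ∈ 𝒮, V ⊆ s) ∧ ∅ ∉ 𝒮 ∧ (∀ t ∈ s, ∃ V ∈ 𝒮, t ∈ V) ∧
      ∀ V ∈ 𝒮, ∀ W ∈ 𝒮, V ≠ W → Disjoint V W ∧ NonCr V W := by
  simp only [ncParts, Finset.mem_filter, Finset.mem_powerset, Finset.subset_iff, and_assoc]

/-- The sum over the non-crossing partitions of `s` of the product of the weights of the blocks. -/
noncomputable def ncSum (w : Finset α → ℂ) (s : Finset α) : ℂ :=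
  ∑ 𝒮 ∈ ncParts s, ∏ V ∈ 𝒮, w V

/-- The weight `w` restricted to the finsets that do not cross `V`. -/
noncomputable def restr (V : Finset α) (w : Finset α → ℂ) (W : Finset α) : ℂ :=
  if NonCr V W then w W else 0

theorem ncSum_congr {w w' : Finset α → ℂ} {s : Finset α}
    (h : ∀ V ⊆ s, V.Nonempty → w V = w' V) : ncSum w s = ncSum w' s := by
  refine Finset.sum_congr rfl fun 𝒮 h𝒮 => Finset.prod_congr rfl fun V hV => ?_
  rw [mem_ncParts] at h𝒮
  refine h V (h𝒮.1 V hV) (Finset.nonempty_iff_ne_empty.2 ?_)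
  rintro rfl
  exact h𝒮.2.1 hV

theorem ncSum_empty (w : Finset α → ℂ) : ncSum w ∅ = 1 := by
  have : ncParts (∅ : Finset α) = {∅} := by
    ext 𝒮
    rw [mem_ncParts, Finset.mem_singleton]
    constructor
    · rintro ⟨h1, h2, -⟩
      refine Finset.eq_empty_of_forall_notMem fun V hV => ?_
      rw [Finset.subset_empty.1 (h1 V hV)] at hV
      exact h2 hV
    · rintro rfl
      simp
  rw [ncSum, this]
  simp

/-- Expansion of `ncSum` according to the block of a point. -/
theorem ncSum_extract (w : Finset α → ℂ) {s : Finset α} {p : α} (hp : p ∈ s) :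
    ncSum w s = ∑ V ∈ s.powerset.filter (p ∈ ·), w V * ncSum (restr V w) (s \ V) := by
  -- `restr V w` vanishes on blocks crossing `V`, so it leaves exactly the partitions of the
  -- complement that are compatible with the block `V`.
  have hr : ∀ V ∈ s.powerset.filter (p ∈ ·), w V * ncSum (restr V w) (s \ V) =
      ∑ 𝒬 ∈ (ncParts (s \ V)).filter (fun 𝒬 => ∀ W ∈ 𝒬, NonCr V W), w V * ∏ W ∈ 𝒬, w W := by
    intro V _
    rw [← Finset.mul_sum, ncSum, Finset.sum_filter]
    congr 1
    refine Finset.sum_congr rfl fun 𝒬 _ => ?_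
    split_ifs with h
    · exact Finset.prod_congr rfl fun W hW => if_pos (h W hW)
    · push Not at h
      obtain ⟨W, hW, hn⟩ := h
      exact Finset.prod_eq_zero hW (if_neg hn)
  rw [Finset.sum_congr rfl hr, Finset.sum_sigma', ncSum]
  symm
  have hnot : ∀ (V : Finset α) (𝒬 : Finset (Finset α)), p ∈ V → 𝒬 ∈ ncParts (s \ V) →
      ∀ W ∈ 𝒬, p ∉ W := by
    intro V 𝒬 hV h𝒬 W hW hpW
    exact (Finset.mem_sdiff.1 ((mem_ncParts.1 h𝒬).1 W hW hpW)).2 hV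
  refine Finset.sum_bij (fun x _ => insert x.1 x.2) ?_ ?_ ?_ ?_
  · rintro ⟨V, 𝒬⟩ h
    simp only [Finset.mem_sigma, Finset.mem_filter, Finset.mem_powerset] at h
    obtain ⟨⟨hVs, hpV⟩, h𝒬, hN⟩ := h
    obtain ⟨h1, h2, h3, h4⟩ := mem_ncParts.1 h𝒬
    have hd : ∀ W ∈ 𝒬, Disjoint V W := fun W hW =>
      (Finset.disjoint_sdiff).mono_right (h1 W hW)
    refine mem_ncParts.2 ⟨?_, ?_, ?_, ?_⟩
    · intro W hW
      rcases Finset.mem_insert.1 hW with rfl | hW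
      · exact hVs
      · exact (h1 W hW).trans Finset.sdiff_subset
    · intro h
      rcases Finset.mem_insert.1 h with h | h
      · exact absurd (show p ∈ (∅ : Finset α) from (show ∅ = V from h) ▸ hpV) (by simp)
      · exact h2 h
    · intro t ht
      by_cases htV : t ∈ V
      · exact ⟨V, Finset.mem_insert_self _ _, htV⟩
      · obtain ⟨W, hW, htW⟩ := h3 t (Finset.mem_sdiff.2 ⟨ht, htV⟩)
        exact ⟨W, Finset.mem_insert_of_mem hW, htW⟩
    · intro W hW W' hW' hne
      rcases Finset.mem_insert.1 hW with rfl | hW <;> rcases Finset.mem_insert.1 hW' with rfl | hW'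
      · exact absurd rfl hne
      · exact ⟨hd _ hW', hN _ hW'⟩
      · exact ⟨(hd _ hW).symm, (hN _ hW).symm⟩
      · exact h4 W hW W' hW' hne
  · rintro ⟨V, 𝒬⟩ h ⟨V', 𝒬'⟩ h' heq
    simp only [Finset.mem_sigma, Finset.mem_filter, Finset.mem_powerset] at h h' heq
    obtain ⟨⟨hVs, hpV⟩, h𝒬, hN⟩ := h
    obtain ⟨⟨hVs', hpV'⟩, h𝒬', hN'⟩ := h'
    have hVV : V = V' := by
      have : V ∈ insert V' 𝒬' := heq ▸ Finset.mem_insert_self _ _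
      rcases Finset.mem_insert.1 this with h | h
      · exact h
      · exact absurd hpV (hnot V' 𝒬' hpV' h𝒬' V h)
    subst hVV
    have e1 := Finset.erase_insert (fun h => hnot V 𝒬 hpV h𝒬 V h hpV)
    have e2 := Finset.erase_insert (fun h => hnot V 𝒬' hpV h𝒬' V h hpV)
    rw [← e1, heq, e2]
  · intro 𝒮 h𝒮
    obtain ⟨h1, h2, h3, h4⟩ := mem_ncParts.1 h𝒮
    obtain ⟨V, hV, hpV⟩ := h3 p hp
    refine ⟨⟨V, 𝒮.erase V⟩, ?_, Finset.insert_erase hV⟩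
    simp only [Finset.mem_sigma, Finset.mem_filter, Finset.mem_powerset]
    have key : ∀ W ∈ 𝒮.erase V, Disjoint V W ∧ NonCr V W := fun W hW =>
      h4 V hV W (Finset.mem_of_mem_erase hW) (Finset.ne_of_mem_erase hW).symm
    refine ⟨⟨h1 V hV, hpV⟩, mem_ncParts.2 ⟨?_, ?_, ?_, ?_⟩, fun W hW => (key W hW).2⟩
    · intro W hW
      exact Finset.subset_sdiff.2 ⟨h1 W (Finset.mem_of_mem_erase hW), (key W hW).1.symm⟩
    · exact fun h => h2 (Finset.mem_of_mem_erase h)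
    · intro t ht
      obtain ⟨ht, htV⟩ := Finset.mem_sdiff.1 ht
      obtain ⟨W, hW, htW⟩ := h3 t ht
      refine ⟨W, Finset.mem_erase.2 ⟨?_, hW⟩, htW⟩
      rintro rfl
      exact htV htW
    · exact fun W hW W' hW' => h4 W (Finset.mem_of_mem_erase hW) W' (Finset.mem_of_mem_erase hW')
  · rintro ⟨V, 𝒬⟩ h
    simp only [Finset.mem_sigma, Finset.mem_filter, Finset.mem_powerset] at h
    exact (Finset.prod_insert (fun h' => hnot V 𝒬 h.1.2 h.2.1 V h' h.1.2)).symm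

theorem mem_powerset_filter {s : Finset α} {p : α} {V : Finset α} :
    V ∈ s.powerset.filter (p ∈ ·) ↔ V ⊆ s ∧ p ∈ V := by simp

/-- The contribution of the one-block partition, and the others. -/
theorem ncSum_eq_add (w : Finset α → ℂ) {s : Finset α} {p : α} (hp : p ∈ s) :
    ncSum w s = w s + ∑ V ∈ (s.powerset.filter (p ∈ ·)).erase s,
      w V * ncSum (restr V w) (s \ V) := by
  rw [ncSum_extract w hp, ← Finset.add_sum_erase _ _ (mem_powerset_filter.2 ⟨subset_rfl, hp⟩)]
  simp [ncSum_empty]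

theorem mem_erase_filter {s : Finset α} {p : α} {V : Finset α} :
    V ∈ (s.powerset.filter (p ∈ ·)).erase s ↔ V ⊂ s ∧ p ∈ V := by
  rw [Finset.mem_erase, mem_powerset_filter, Finset.ssubset_iff_subset_ne]
  tauto

/-- The weights are determined by their sums over non-crossing partitions. -/
theorem weight_eq_of_ncSum_eq {w w' : Finset α → ℂ} (s : Finset α) (hs : s.Nonempty)
    (h : ∀ t ⊆ s, t.Nonempty → ncSum w t = ncSum w' t) : w s = w' s := by
  induction s using Finset.strongInductionOn with
  | _ s ih =>
    obtain ⟨p, hp⟩ := hs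
    have ih' : ∀ V ⊂ s, V.Nonempty → w V = w' V := fun V hV hne =>
      ih V hV hne fun t ht => h t (ht.trans hV.1)
    have h1 := h s subset_rfl ⟨p, hp⟩
    rw [ncSum_eq_add w hp, ncSum_eq_add w' hp] at h1
    -- Apart from the one-block term, only proper subsets of `s` occur: the blocks `V ≠ s`, and the
    -- blocks of the complement, which miss `p`.
    rw [Finset.sum_congr rfl (g := fun V => w' V * ncSum (restr V w') (s \ V))] at h1
    · exact add_right_cancel h1
    · intro V hV
      obtain ⟨hVs, hpV⟩ := mem_erase_filter.1 hV
      rw [ih' V hVs ⟨p, hpV⟩]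
      congr 1
      refine ncSum_congr fun W hW hne => ?_
      have hlt : W ⊂ s := by
        refine Finset.ssubset_iff_subset_ne.2 ⟨hW.trans Finset.sdiff_subset, ?_⟩
        rintro rfl
        exact (Finset.mem_sdiff.1 (hW hp)).2 hpV
      simp only [restr, ih' W hlt hne]

/-- Crossing depends only on the relative order of the points. This lets finsets of any linear order
replace `Fin n`. -/
theorem ncSum_map (e : β ↪o α) (w : Finset α → ℂ) (s : Finset β) :
    ncSum w (s.map e.toEmbedding) = ncSum (fun V => w (V.map e.toEmbedding)) s := by
  induction s using Finset.strongInductionOn generalizing w with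
  | _ s ih =>
    rcases s.eq_empty_or_nonempty with rfl | ⟨p, hp⟩
    · simp [ncSum_empty]
    · rw [ncSum_extract w (Finset.mem_map_of_mem _ hp), ncSum_extract _ hp]
      symm
      refine Finset.sum_bij (fun V _ => V.map e.toEmbedding) ?_ ?_ ?_ ?_
      · intro V hV
        rw [mem_powerset_filter] at hV ⊢
        exact ⟨Finset.map_subset_map.2 hV.1, Finset.mem_map_of_mem _ hV.2⟩
      · exact fun V _ V' _ h => Finset.map_injective _ h
      · intro V hV
        rw [mem_powerset_filter] at hV
        obtain ⟨V', hV', rfl⟩ := Finset.subset_map_iff.1 hV.1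
        exact ⟨V', mem_powerset_filter.2 ⟨hV', (Finset.mem_map' _).1 hV.2⟩, rfl⟩
      · intro V hV
        rw [mem_powerset_filter] at hV
        rw [← Finset.map_sdiff, ih _ (Finset.ssubset_iff_subset_ne.2 ⟨Finset.sdiff_subset, ?_⟩)]
        · simp only [restr, nonCr_map]
          rfl
        · intro h
          rw [← h] at hp
          exact (Finset.mem_sdiff.1 hp).2 hV.2

theorem sum_NC_eq_ncSum (n : ℕ) (w : Finset (Fin n) → ℂ) :
    ∑ π ∈ NC n, ∏ V ∈ π.parts, w V = ncSum w Finset.univ := by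
  refine Finset.sum_bij (fun π _ => π.parts) ?_ ?_ ?_ ?_
  · intro π hπ
    have hπ := (Finset.mem_filter.1 hπ).2
    refine mem_ncParts.2 ⟨fun V _ => Finset.subset_univ V, π.bot_notMem, fun t ht => ?_, ?_⟩
    · exact ⟨π.part t, π.part_mem.2 ht, π.mem_part ht⟩
    · refine fun V hV W hW hne => ⟨π.disjoint hV hW hne, ?_, ?_⟩
      · rintro ⟨i, j, k, l, h1, h2, h3, h4, h5, h6, h7⟩
        exact hπ V hV W hW hne i j k l h1 h2 h3 h4 h5 h6 h7
      · rintro ⟨i, j, k, l, h1, h2, h3, h4, h5, h6, h7⟩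
        exact hπ W hW V hV hne.symm i j k l h1 h2 h3 h4 h5 h6 h7
  · exact fun π _ π' _ h => Finpartition.ext h
  · intro 𝒮 h𝒮
    obtain ⟨h1, h2, h3, h4⟩ := mem_ncParts.1 h𝒮
    refine ⟨⟨𝒮, ?_, ?_, h2⟩, ?_, rfl⟩
    · exact Finset.supIndep_iff_pairwiseDisjoint.2 fun V hV W hW hne => (h4 V hV W hW hne).1
    · refine Finset.eq_univ_of_forall fun t => ?_
      obtain ⟨V, hV, ht⟩ := h3 t (Finset.mem_univ t)
      exact Finset.mem_sup.2 ⟨V, hV, ht⟩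
    · refine Finset.mem_filter.2 ⟨Finset.mem_univ _, ?_⟩
      intro V hV W hW hne i j k l a b c d e f g
      exact (h4 V hV W hW hne).2.1 ⟨i, j, k, l, a, b, c, d, e, f, g⟩
  · exact fun π _ => rfl

/-- No point of `W` lies in $[p,q]$, so in any crossing with `W` the point `q` may be replaced by
`p`. -/
theorem nonCr_insert_iff {V W : Finset α} {p q : α} (hpq : p < q) (hpV : p ∈ V)
    (hpW : p ∉ W) (hqW : q ∉ W) (hadj : ∀ t ∈ W, ¬ (p < t ∧ t < q)) :
    NonCr (insert q V) W ↔ NonCr V W := by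
  refine ⟨fun h => h.mono (Finset.subset_insert _ _) subset_rfl, fun h => ?_⟩
  have hW : ∀ t ∈ W, t < p ∨ q < t := by
    intro t ht
    have h1 : t ≠ p := fun e => hpW (e ▸ ht)
    have h2 : t ≠ q := fun e => hqW (e ▸ ht)
    have h3 := hadj t ht
    rcases lt_or_gt_of_ne h1 with h1 | h1
    · exact Or.inl h1
    · exact Or.inr (lt_of_le_of_ne (not_lt.1 fun h => h3 ⟨h1, h⟩) h2.symm)
  have hV : ∀ t ∈ insert q V, ∃ t' ∈ V, ∀ x ∈ W, (x < t ↔ x < t') ∧ (t < x ↔ t' < x) := by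
    intro t ht
    rcases Finset.mem_insert.1 ht with rfl | ht
    · refine ⟨p, hpV, fun x hx => ?_⟩
      rcases hW x hx with h | h
      · exact ⟨⟨fun _ => h, fun _ => h.trans hpq⟩,
          ⟨fun h' => absurd h' (h.trans hpq).asymm, fun h' => absurd h' h.asymm⟩⟩
      · exact ⟨⟨fun h' => absurd h' h.asymm, fun h' => absurd h' (hpq.trans h).asymm⟩,
          ⟨fun _ => hpq.trans h, fun _ => h⟩⟩
    · exact ⟨t, ht, fun x _ => ⟨Iff.rfl, Iff.rfl⟩⟩
  constructor
  · rintro ⟨i, j, k, l, h1, h2, h3, h4, h5, h6, h7⟩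
    obtain ⟨i', hi, hi'⟩ := hV i h4
    obtain ⟨k', hk, hk'⟩ := hV k h5
    exact h.1 ⟨i', j, k', l, (hi' j h6).2.1 h1, (hk' j h6).1.1 h2, (hk' l h7).2.1 h3, hi, hk, h6, h7⟩
  · rintro ⟨i, j, k, l, h1, h2, h3, h4, h5, h6, h7⟩
    obtain ⟨j', hj, hj'⟩ := hV j h6
    obtain ⟨l', hl, hl'⟩ := hV l h7
    exact h.2 ⟨i, j', k, l', (hj' i h4).1.1 h1, (hj' k h5).2.1 h2, (hl' k h5).1.1 h3, h4, h5, hj, hl⟩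

theorem nonCr_union_iff {A B W : Finset α} {p q : α} (hpq : p < q) (hpA : p ∈ A) (hqB : q ∈ B)
    (hpW : p ∉ W) (hqW : q ∉ W) (hadj : ∀ t ∈ W, ¬ (p < t ∧ t < q)) :
    NonCr (A ∪ B) W ↔ NonCr A W ∧ NonCr B W := by
  refine ⟨fun h => ⟨h.mono Finset.subset_union_left subset_rfl,
    h.mono Finset.subset_union_right subset_rfl⟩, fun ⟨hA, hB⟩ => ?_⟩
  have hW : ∀ t ∈ W, t < p ∨ q < t := by
    intro t ht
    have h1 : t ≠ p := fun e => hpW (e ▸ ht)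
    have h2 : t ≠ q := fun e => hqW (e ▸ ht)
    have h3 := hadj t ht
    rcases lt_or_gt_of_ne h1 with h1 | h1
    · exact Or.inl h1
    · exact Or.inr (lt_of_le_of_ne (not_lt.1 fun h => h3 ⟨h1, h⟩) h2.symm)
  -- Seen from `W`, the points `p` and `q` coincide, so each of the two sets contains this common
  -- point. If `i` and `k` come from different sets and separate `j` from `l`, the common point
  -- together with `i` or with `k` still separates two points of `W`. The sets are quantified again
  -- so that their roles can be exchanged.
  have key : ∀ A B : Finset α, (∃ x ∈ A, x = p ∨ x = q) → (∃ x ∈ B, x = p ∨ x = q) →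
      NonCr A W → NonCr B W → ∀ i j k l, i ∈ A → k ∈ B → j ∈ W → l ∈ W →
      ((i < j ∧ j < k ∧ k < l) ∨ (l < i ∧ i < j ∧ j < k)) → False := by
    rintro A B ⟨x, hxA, hx⟩ ⟨y, hyB, hy⟩ hA hB i j k l hi hk hj hl h
    have hx' : ∀ t ∈ W, (t < p → t < x) ∧ (q < t → x < t) := by
      rcases hx with rfl | rfl
      · exact fun t _ => ⟨id, fun h => hpq.trans h⟩
      · exact fun t _ => ⟨fun h => h.trans hpq, id⟩
    have hy' : ∀ t ∈ W, (t < p → t < y) ∧ (q < t → y < t) := by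
      rcases hy with rfl | rfl
      · exact fun t _ => ⟨id, fun h => hpq.trans h⟩
      · exact fun t _ => ⟨fun h => h.trans hpq, id⟩
    rcases h with ⟨h1, h2, h3⟩ | ⟨h1, h2, h3⟩
    · rcases hW j hj with hjp | hqj
      · rcases hW l hl with hlp | hql
        · exact hB.2 ⟨j, k, l, y, h2, h3, (hy' l hl).1 hlp, hj, hl, hk, hyB⟩
        · exact hA.1 ⟨i, j, x, l, h1, (hx' j hj).1 hjp, (hx' l hl).2 hql, hi, hxA, hj, hl⟩
      · exact hB.1 ⟨y, j, k, l, (hy' j hj).2 hqj, h2, h3, hyB, hk, hj, hl⟩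
    · rcases hW j hj with hjp | hqj
      · exact hA.2 ⟨l, i, j, x, h1, h2, (hx' j hj).1 hjp, hl, hj, hi, hxA⟩
      · rcases hW l hl with hlp | hql
        · exact hB.2 ⟨l, y, j, k, (hy' l hl).1 hlp, (hy' j hj).2 hqj, h3, hl, hj, hyB, hk⟩
        · exact hA.1 ⟨x, l, i, j, (hx' l hl).2 hql, h1, h2, hxA, hi, hl, hj⟩
  have hpA' : ∃ x ∈ A, x = p ∨ x = q := ⟨p, hpA, Or.inl rfl⟩
  have hqB' : ∃ x ∈ B, x = p ∨ x = q := ⟨q, hqB, Or.inr rfl⟩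
  constructor
  · rintro ⟨i, j, k, l, h1, h2, h3, h4, h5, h6, h7⟩
    rcases Finset.mem_union.1 h4 with h4 | h4 <;> rcases Finset.mem_union.1 h5 with h5 | h5
    · exact hA.1 ⟨i, j, k, l, h1, h2, h3, h4, h5, h6, h7⟩
    · exact key A B hpA' hqB' hA hB i j k l h4 h5 h6 h7 (Or.inl ⟨h1, h2, h3⟩)
    · exact key B A hqB' hpA' hB hA i j k l h4 h5 h6 h7 (Or.inl ⟨h1, h2, h3⟩)
    · exact hB.1 ⟨i, j, k, l, h1, h2, h3, h4, h5, h6, h7⟩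
  · rintro ⟨i, j, k, l, h1, h2, h3, h4, h5, h6, h7⟩
    rcases Finset.mem_union.1 h6 with h6 | h6 <;> rcases Finset.mem_union.1 h7 with h7 | h7
    · exact hA.2 ⟨i, j, k, l, h1, h2, h3, h4, h5, h6, h7⟩
    · exact key A B hpA' hqB' hA hB j k l i h6 h7 h5 h4 (Or.inr ⟨h1, h2, h3⟩)
    · exact key B A hqB' hpA' hB hA j k l i h6 h7 h5 h4 (Or.inr ⟨h1, h2, h3⟩)
    · exact hB.2 ⟨i, j, k, l, h1, h2, h3, h4, h5, h6, h7⟩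

/-- The sets `A` with `p ∈ A ⊆ V` that do not cross their complement in `insert q V`. -/
noncomputable def splits (p q : α) (V : Finset α) : Finset (Finset α) :=
  V.powerset.filter fun A => p ∈ A ∧ NonCr A (insert q V \ A)

theorem mem_splits {p q : α} {V A : Finset α} :
    A ∈ splits p q V ↔ A ⊆ V ∧ p ∈ A ∧ NonCr A (insert q V \ A) := by
  simp [splits]

/-- The weight obtained from `w` by gluing the point `q` to the point `p`. -/
noncomputable def glue (p q : α) (w : Finset α → ℂ) (V : Finset α) : ℂ :=
  if p ∈ V then w (insert q V) + ∑ A ∈ splits p q V, w A * w (insert q V \ A) else w V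

/-- In a non-crossing partition of `insert q s`, either `p` and `q` share a block, or they lie in
distinct blocks `A` and `B`. Merging the two blocks and deleting `q` gives a non-crossing partition
of `s`; the two summands in `glue` count its preimages. -/
theorem ncSum_glue (w : Finset α → ℂ) {s : Finset α} {p q : α} (hpq : p < q) (hp : p ∈ s)
    (hq : q ∉ s) (hadj : ∀ t ∈ s, ¬ (p < t ∧ t < q)) :
    ncSum (glue p q w) s = ncSum w (insert q s) := by
  rw [ncSum_extract w (Finset.mem_insert_of_mem hp),
    ← Finset.sum_filter_add_sum_filter_not _ (fun A => q ∈ A), ncSum_extract _ hp]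
  have hL : ∀ V ∈ s.powerset.filter (p ∈ ·),
      glue p q w V * ncSum (restr V (glue p q w)) (s \ V) =
      w (insert q V) * ncSum (restr V w) (s \ V) +
        ∑ A ∈ splits p q V, w A * w (insert q V \ A) * ncSum (restr V w) (s \ V) := by
    intro V hV
    rw [mem_powerset_filter] at hV
    have : ncSum (restr V (glue p q w)) (s \ V) = ncSum (restr V w) (s \ V) := by
      refine ncSum_congr fun W hW _ => ?_
      have hpW : p ∉ W := fun h => (Finset.mem_sdiff.1 (hW h)).2 hV.2
      simp only [restr, glue, if_neg hpW]
    rw [this, glue, if_pos hV.2, add_mul, Finset.sum_mul]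
  rw [Finset.sum_congr rfl hL, Finset.sum_add_distrib]
  congr 1
  · refine Finset.sum_bij (fun V _ => insert q V) ?_ ?_ ?_ ?_
    · intro V hV
      rw [mem_powerset_filter] at hV
      rw [Finset.mem_filter, mem_powerset_filter]
      exact ⟨⟨Finset.insert_subset_insert _ hV.1, Finset.mem_insert_of_mem hV.2⟩,
        Finset.mem_insert_self _ _⟩
    · intro V hV V' hV' h
      rw [mem_powerset_filter] at hV hV'
      rw [← Finset.erase_insert (fun h => hq (hV.1 h)), h,
        Finset.erase_insert (fun h => hq (hV'.1 h))]
    · intro A hA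
      rw [Finset.mem_filter, mem_powerset_filter] at hA
      refine ⟨A.erase q, mem_powerset_filter.2 ⟨?_, Finset.mem_erase.2 ⟨hpq.ne, hA.1.2⟩⟩,
        Finset.insert_erase hA.2⟩
      exact (Finset.erase_subset_erase q hA.1.1).trans (Finset.erase_insert hq).subset
    · intro V hV
      rw [mem_powerset_filter] at hV
      have hs : insert q s \ insert q V = s \ V := by
        rw [Finset.insert_sdiff_insert, Finset.sdiff_insert_of_notMem hq]
      rw [hs]
      congr 1
      refine ncSum_congr fun W hW _ => ?_
      have hpW : p ∉ W := fun h => (Finset.mem_sdiff.1 (hW h)).2 hV.2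
      have hqW : q ∉ W := fun h => hq (Finset.mem_sdiff.1 (hW h)).1
      simp only [restr, nonCr_insert_iff hpq hV.2 hpW hqW
        (fun t ht => hadj t (Finset.mem_sdiff.1 (hW ht)).1)]
  -- A second extraction, now at `q`, turns the separated case into a sum over pairs of blocks `A`,
  -- `B`.
  · have hR : ∀ A ∈ ((insert q s).powerset.filter (p ∈ ·)).filter (q ∉ ·),
        w A * ncSum (restr A w) (insert q s \ A) =
        ∑ B ∈ (insert q s \ A).powerset.filter (fun B => q ∈ B ∧ NonCr A B),
          w A * (w B * ncSum (restr B (restr A w)) ((insert q s \ A) \ B)) := by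
      intro A hA
      rw [Finset.mem_filter, mem_powerset_filter] at hA
      rw [ncSum_extract _ (Finset.mem_sdiff.2 ⟨Finset.mem_insert_self q s, hA.2⟩),
        Finset.mul_sum, ← Finset.filter_filter, Finset.sum_filter (fun B => NonCr A B)]
      refine Finset.sum_congr rfl fun B hB => ?_
      split_ifs with h
      · rw [restr, if_pos h]
      · rw [restr, if_neg h]
        simp
    rw [Finset.sum_congr rfl hR, Finset.sum_sigma', Finset.sum_sigma']
    refine Finset.sum_bij' (fun x _ => (⟨x.2, insert q x.1 \ x.2⟩ : Σ _ : Finset α, Finset α))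
      (fun x _ => (⟨(x.1 ∪ x.2).erase q, x.1⟩ : Σ _ : Finset α, Finset α)) ?_ ?_ ?_ ?_ ?_
    · rintro ⟨V, A⟩ h
      simp only [Finset.mem_sigma, Finset.mem_filter, mem_splits, Finset.mem_powerset] at h ⊢
      obtain ⟨⟨hVs, hpV⟩, hAV, hpA, hN⟩ := h
      have hqV : q ∉ V := fun h => hq (hVs h)
      exact ⟨⟨⟨(hAV.trans hVs).trans (Finset.subset_insert _ _), hpA⟩, fun h => hqV (hAV h)⟩,
        Finset.sdiff_subset_sdiff (Finset.insert_subset_insert _ hVs) subset_rfl,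
        Finset.mem_sdiff.2 ⟨Finset.mem_insert_self _ _, fun h => hqV (hAV h)⟩, hN⟩
    · rintro ⟨A, B⟩ h
      simp only [Finset.mem_sigma, Finset.mem_filter, mem_splits, Finset.mem_powerset] at h ⊢
      obtain ⟨⟨⟨hAs, hpA⟩, hqA⟩, hBs, hqB, hN⟩ := h
      have hdis : Disjoint A B := Finset.disjoint_sdiff.mono_right hBs
      have e1 : insert q ((A ∪ B).erase q) \ A = B := by
        rw [Finset.insert_erase (Finset.mem_union_right _ hqB), Finset.union_sdiff_left,
          Finset.sdiff_eq_self_of_disjoint hdis.symm]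
      refine ⟨⟨?_, ?_⟩, ?_, hpA, e1.symm ▸ hN⟩
      · refine (Finset.erase_subset_erase q (Finset.union_subset hAs
          (hBs.trans Finset.sdiff_subset))).trans (Finset.erase_insert hq).subset
      · exact Finset.mem_erase.2 ⟨hpq.ne, Finset.mem_union_left _ hpA⟩
      · exact fun t ht => Finset.mem_erase.2 ⟨fun e => hqA (e ▸ ht), Finset.mem_union_left _ ht⟩
    · rintro ⟨V, A⟩ h
      simp only [Finset.mem_sigma, Finset.mem_filter, mem_splits, Finset.mem_powerset] at h ⊢
      obtain ⟨⟨hVs, hpV⟩, hAV, hpA, hN⟩ := h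
      rw [Finset.union_sdiff_of_subset (hAV.trans (Finset.subset_insert _ _)),
        Finset.erase_insert (fun h => hq (hVs h))]
    · rintro ⟨A, B⟩ h
      simp only [Finset.mem_sigma, Finset.mem_filter, Finset.mem_powerset] at h ⊢
      obtain ⟨⟨⟨hAs, hpA⟩, hqA⟩, hBs, hqB, hN⟩ := h
      have hdis : Disjoint A B := Finset.disjoint_sdiff.mono_right hBs
      rw [Finset.insert_erase (Finset.mem_union_right _ hqB), Finset.union_sdiff_left,
          Finset.sdiff_eq_self_of_disjoint hdis.symm]
    · rintro ⟨V, A⟩ h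
      simp only [Finset.mem_sigma, Finset.mem_filter, mem_splits, Finset.mem_powerset] at h ⊢
      obtain ⟨⟨hVs, hpV⟩, hAV, hpA, hN⟩ := h
      have hqV : q ∉ V := fun h => hq (hVs h)
      have hsd : (insert q s \ A) \ (insert q V \ A) = s \ V := by
        rw [sdiff_sdiff_left, Finset.sup_eq_union,
          Finset.union_sdiff_of_subset (hAV.trans (Finset.subset_insert _ _)),
          Finset.insert_sdiff_insert, Finset.sdiff_insert_of_notMem hq]
      rw [hsd, mul_assoc]
      congr 2
      refine ncSum_congr fun W hW _ => ?_
      have hpW : p ∉ W := fun h => (Finset.mem_sdiff.1 (hW h)).2 hpV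
      have hqW : q ∉ W := fun h => hq (Finset.mem_sdiff.1 (hW h)).1
      have ha : ∀ t ∈ W, ¬ (p < t ∧ t < q) := fun t ht => hadj t (Finset.mem_sdiff.1 (hW ht)).1
      have hiff : NonCr V W ↔ NonCr (insert q V \ A) W ∧ NonCr A W := by
        rw [← nonCr_insert_iff hpq hpV hpW hqW ha, and_comm, ← nonCr_union_iff hpq hpA
          (Finset.mem_sdiff.2 ⟨Finset.mem_insert_self _ _, fun h => hqV (hAV h)⟩) hpW hqW ha,
          Finset.union_sdiff_of_subset (hAV.trans (Finset.subset_insert _ _))]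
      simp only [restr, hiff, ite_and]

end NonCrossingSums

/-! ### Cumulants over linear orders: products as entries and multilinearity -/

section Cumulants

open scoped Classical

variable {α β : Type*} [LinearOrder α] [LinearOrder β] (P : NCProbSpace.{u})

/-- The free cumulant of a list of random variables. -/
noncomputable def cum (l : List P.carrier) : ℂ := freeCumulant P l.length l.get

theorem freeCumulant_eq_cum (n : ℕ) (x : Fin n → P.carrier) :
    freeCumulant P n x = cum P (List.ofFn x) := by
  have : ∀ (l : List P.carrier) (h : l.length = n),
      freeCumulant P n (fun t => l.get (t.cast h.symm)) = cum P l := by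
    rintro l rfl
    rfl
  rw [← this _ (List.length_ofFn)]
  congr 1
  ext t
  simp

/-- The free cumulant of the random variables `x t`, `t ∈ V`, in increasing order of `t`. -/
noncomputable def kap (x : α → P.carrier) (V : Finset α) : ℂ := cum P (V.sort.map x)

theorem ofFn_orderEmbOfFin {γ : Type*} (x : α → γ) (V : Finset α) {n : ℕ} (h : V.card = n) :
    List.ofFn (fun t => x (V.orderEmbOfFin h t)) = V.sort.map x := by
  rw [← V.listMap_orderEmbOfFin_finRange h, List.map_map, List.ofFn_eq_map]
  rfl

theorem kap_eq_freeCumulant (x : α → P.carrier) (V : Finset α) {n : ℕ} (h : V.card = n) :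
    kap P x V = freeCumulant P n (fun t => x (V.orderEmbOfFin h t)) := by
  rw [freeCumulant_eq_cum, ofFn_orderEmbOfFin, kap]

variable {P} in
theorem kap_congr {x y : α → P.carrier} {V : Finset α} (h : ∀ t ∈ V, x t = y t) :
    kap P x V = kap P y V := by
  rw [kap, kap, List.map_congr_left fun t ht => h t ((Finset.mem_sort _).1 ht)]

theorem sort_map_orderEmb (e : β ↪o α) (V : Finset β) :
    (V.map e.toEmbedding).sort = V.sort.map e := by
  have h := ofFn_orderEmbOfFin id (V.map e.toEmbedding) (Finset.card_map e.toEmbedding)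
  rw [List.map_id] at h
  rw [← ofFn_orderEmbOfFin e V rfl, ← h]
  congr 1
  have := Finset.orderEmbOfFin_unique' (s := V.map e.toEmbedding)
    (Finset.card_map e.toEmbedding) (f := (V.orderEmbOfFin rfl).trans e)
    (fun t => Finset.mem_map_of_mem _ (V.orderEmbOfFin_mem rfl t))
  rw [← this]
  rfl

theorem kap_map (e : β ↪o α) (x : α → P.carrier) (V : Finset β) :
    kap P x (V.map e.toEmbedding) = kap P (x ∘ e) V := by
  rw [kap, kap, sort_map_orderEmb, List.map_map]

theorem kap_univ {n : ℕ} (x : Fin n → P.carrier) :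
    kap P x Finset.univ = freeCumulant P n x := by
  rw [kap, Fin.sort_univ, freeCumulant_eq_cum, List.ofFn_eq_map]

/-- The product of the `x t`, `t ∈ V`, in increasing order of `t`. -/
def oprod {R : Type*} [Monoid R] (x : α → R) (V : Finset α) : R := (V.sort.map x).prod

/-- The moment-cumulant formula for the variables indexed by a finset of a linear order. -/
theorem moment_eq_ncSum (x : α → P.carrier) (s : Finset α) :
    P.φ (oprod x s) = ncSum (kap P x) s := by
  have h := moment_eq_sum_freeCumulant P s.card (fun t => x (s.orderEmbOfFin rfl t))
  rw [ofFn_orderEmbOfFin] at h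
  rw [oprod, h]
  conv_rhs => rw [← Finset.map_orderEmbOfFin_univ s rfl, ncSum_map, ← sum_NC_eq_ncSum]
  refine Finset.sum_congr rfl fun π _ => Finset.prod_congr rfl fun V _ => ?_
  rw [kap_map, kap_eq_freeCumulant P _ V rfl]
  rfl

theorem sort_union {L R : Finset α} (h : ∀ a ∈ L, ∀ b ∈ R, a < b) :
    (L ∪ R).sort = L.sort ++ R.sort := by
  refine List.Perm.eq_of_pairwise' (Finset.pairwise_sort _ _) ?_ ?_
  · refine List.pairwise_append.2 ⟨Finset.pairwise_sort _ _, Finset.pairwise_sort _ _, ?_⟩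
    exact fun a ha b hb => (h a ((Finset.mem_sort _).1 ha) b ((Finset.mem_sort _).1 hb)).le
  · rw [List.perm_ext_iff_of_nodup (Finset.sort_nodup _ _)]
    · simp
    · refine List.Nodup.append (Finset.sort_nodup _ _) (Finset.sort_nodup _ _) ?_
      intro a ha hb
      exact lt_irrefl a (h a ((Finset.mem_sort _).1 ha) a ((Finset.mem_sort _).1 hb))

theorem sort_eq_filter {s : Finset α} {p : α} (hp : p ∈ s) :
    s.sort = (s.filter (· < p)).sort ++ p :: (s.filter (p < ·)).sort := by
  have h1 : s = s.filter (· < p) ∪ ({p} ∪ s.filter (p < ·)) := by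
    ext t
    simp only [Finset.mem_union, Finset.mem_filter, Finset.mem_singleton]
    constructor
    · intro h
      rcases lt_trichotomy t p with h' | h' | h' <;> simp [h, h']
    · rintro (h | rfl | h)
      exacts [h.1, hp, h.1]
  conv_lhs => rw [h1]
  rw [sort_union, sort_union]
  · simp
  · simp
  · simp only [Finset.mem_union, Finset.mem_filter, Finset.mem_singleton]
    rintro a ⟨-, ha⟩ b (rfl | ⟨-, hb⟩)
    · exact ha
    · exact ha.trans hb

theorem oprod_eq_filter {R : Type*} [Monoid R] (x : α → R) {s : Finset α} {p : α} (hp : p ∈ s) :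
    oprod x s = oprod x (s.filter (· < p)) * x p * oprod x (s.filter (p < ·)) := by
  simp only [oprod, sort_eq_filter hp, List.map_append, List.map_cons, List.prod_append,
    List.prod_cons, mul_assoc]

theorem oprod_congr {R : Type*} [Monoid R] {x y : α → R} {s : Finset α}
    (h : ∀ t ∈ s, x t = y t) : oprod x s = oprod y s := by
  rw [oprod, oprod, List.map_congr_left fun t ht => h t ((Finset.mem_sort _).1 ht)]

theorem sort_insert_of_adjacent {s : Finset α} {p q : α} (hpq : p < q) (hp : p ∈ s)
    (hq : q ∉ s) (hadj : ∀ t ∈ s, ¬ (p < t ∧ t < q)) :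
    (insert q s).sort = (s.filter (· < p)).sort ++ p :: q :: (s.filter (p < ·)).sort := by
  have e1 : (insert q s).filter (· < p) = s.filter (· < p) := by
    rw [Finset.filter_insert, if_neg hpq.not_gt]
  have e2 : ((insert q s).filter (p < ·)).filter (· < q) = ∅ := by
    refine Finset.filter_eq_empty_iff.2 fun t ht htq => ?_
    rw [Finset.mem_filter, Finset.mem_insert] at ht
    rcases ht.1 with rfl | h
    · exact lt_irrefl _ htq
    · exact hadj t h ⟨ht.2, htq⟩
  have e3 : ((insert q s).filter (p < ·)).filter (q < ·) = s.filter (p < ·) := by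
    ext t
    simp only [Finset.mem_filter, Finset.mem_insert]
    constructor
    · rintro ⟨⟨rfl | h, h1⟩, h2⟩
      · exact absurd h2 (lt_irrefl _)
      · exact ⟨h, h1⟩
    · rintro ⟨h, h1⟩
      refine ⟨⟨Or.inr h, h1⟩, lt_of_le_of_ne (not_lt.1 fun h' => hadj t h ⟨h1, h'⟩) ?_⟩
      rintro rfl
      exact hq h
  rw [sort_eq_filter (Finset.mem_insert_of_mem hp), e1,
    sort_eq_filter (s := (insert q s).filter (p < ·)) (p := q) (by simp [hpq]), e2, e3]
  simp

theorem oprod_glue {R : Type*} [Monoid R] (x : α → R) {s : Finset α} {p q : α} (hpq : p < q)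
    (hp : p ∈ s) (hadj : ∀ t ∈ s, ¬ (p < t ∧ t < q)) (hq : q ∉ s) :
    oprod (Function.update x p (x p * x q)) s = oprod x (insert q s) := by
  have e₁ : oprod (Function.update x p (x p * x q)) (s.filter (· < p)) =
      oprod x (s.filter (· < p)) :=
    oprod_congr fun t ht => Function.update_of_ne (Finset.mem_filter.1 ht).2.ne _ _
  have e₂ : oprod (Function.update x p (x p * x q)) (s.filter (p < ·)) =
      oprod x (s.filter (p < ·)) :=
    oprod_congr fun t ht => Function.update_of_ne (Finset.mem_filter.1 ht).2.ne' _ _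
  rw [oprod_eq_filter _ hp, Function.update_self, e₁, e₂, oprod, oprod, oprod,
    sort_insert_of_adjacent hpq hp hq hadj]
  simp [mul_assoc]

/-- Both sides are weights with the same non-crossing sums on every subset of `s`. If the subset
contains `p`, both sums equal the moment in which `x p` and `x q` stand next to each other;
otherwise neither weight sees the gluing. -/
theorem glue_kap (x : α → P.carrier) {s : Finset α} {p q : α} (hpq : p < q)
    (hq : q ∉ s) (hadj : ∀ t ∈ s, ¬ (p < t ∧ t < q)) (hs : s.Nonempty) :
    kap P (Function.update x p (x p * x q)) s = glue p q (kap P x) s := by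
  refine weight_eq_of_ncSum_eq s hs fun t ht _ => ?_
  have hqt : q ∉ t := fun h => hq (ht h)
  have hadj' : ∀ r ∈ t, ¬ (p < r ∧ r < q) := fun r hr => hadj r (ht hr)
  rw [← moment_eq_ncSum]
  by_cases hp : p ∈ t
  · rw [ncSum_glue _ hpq hp hqt hadj', oprod_glue x hpq hp hadj' hqt, moment_eq_ncSum]
  · have h : oprod (Function.update x p (x p * x q)) t = oprod x t :=
      oprod_congr fun r hr => Function.update_of_ne (fun e : r = p => hp (e ▸ hr)) _ _
    rw [h, moment_eq_ncSum]
    refine ncSum_congr fun V hV _ => ?_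
    rw [glue, if_neg fun h => hp (hV h)]

/-- The free cumulant with a product as one of its entries. -/
theorem kap_update_mul (x : α → P.carrier) {s : Finset α} {p q : α} (hpq : p < q) (hp : p ∈ s)
    (hq : q ∉ s) (hadj : ∀ t ∈ s, ¬ (p < t ∧ t < q)) :
    kap P (Function.update x p (x p * x q)) s =
      kap P x (insert q s) + ∑ A ∈ splits p q s, kap P x A * kap P x (insert q s \ A) := by
  rw [glue_kap P x hpq hq hadj ⟨p, hp⟩, glue, if_pos hp]

/-- Free cumulants are linear in each entry. -/
theorem exists_linearMap_kap (x : α → P.carrier) {s : Finset α} {p : α} (hp : p ∈ s) :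
    ∃ f : P.carrier →ₗ[ℂ] ℂ, ∀ y, f y = kap P (Function.update x p y) s := by
  induction s using Finset.strongInductionOn with
  | _ s ih =>
    have h1 : ∀ V : Finset α, ∃ f : P.carrier →ₗ[ℂ] ℂ, V ⊂ s → p ∈ V →
        ∀ y, f y = kap P (Function.update x p y) V := fun V => by
      by_cases h : V ⊂ s ∧ p ∈ V
      · obtain ⟨f, hf⟩ := ih V h.1 h.2
        exact ⟨f, fun _ _ => hf⟩
      · exact ⟨0, fun h1 h2 => absurd ⟨h1, h2⟩ h⟩
    choose f hf using h1
    -- The moment-cumulant formula solved for its one-block term. The moment is linear in the entry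
    -- at `p`; in every other term the block of `p` is a smaller cumulant, linear by induction, and
    -- the remaining blocks do not involve that entry.
    refine ⟨P.φ ∘ₗ LinearMap.mulRight ℂ (oprod x (s.filter (p < ·))) ∘ₗ
      LinearMap.mulLeft ℂ (oprod x (s.filter (· < p))) -
      ∑ V ∈ (s.powerset.filter (p ∈ ·)).erase s,
        ncSum (restr V (kap P x)) (s \ V) • f V, fun y => ?_⟩
    have hm := moment_eq_ncSum P (Function.update x p y) s
    have h1 : oprod (Function.update x p y) (s.filter (· < p)) = oprod x (s.filter (· < p)) :=
      oprod_congr fun t ht => Function.update_of_ne (Finset.mem_filter.1 ht).2.ne _ _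
    have h2 : oprod (Function.update x p y) (s.filter (p < ·)) = oprod x (s.filter (p < ·)) :=
      oprod_congr fun t ht => Function.update_of_ne (Finset.mem_filter.1 ht).2.ne' _ _
    rw [ncSum_eq_add _ hp, oprod_eq_filter _ hp, Function.update_self, h1, h2,
      ← sub_eq_iff_eq_add] at hm
    rw [← hm]
    simp only [LinearMap.sub_apply, LinearMap.comp_apply, LinearMap.mulLeft_apply,
      LinearMap.mulRight_apply, LinearMap.sum_apply, LinearMap.smul_apply, smul_eq_mul]
    congr 1
    refine Finset.sum_congr rfl fun V hV => ?_
    obtain ⟨hVs, hpV⟩ := mem_erase_filter.1 hV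
    rw [mul_comm, hf V hVs hpV]
    congr 1
    refine ncSum_congr fun W hW _ => ?_
    have hpW : p ∉ W := fun h => (Finset.mem_sdiff.1 (hW h)).2 hpV
    have : kap P x W = kap P (Function.update x p y) W :=
      kap_congr fun t ht => (Function.update_of_ne (fun e : t = p => hpW (e ▸ ht)) _ _).symm
    simp only [restr, this]

theorem kap_update_sum {ι : Type*} (I : Finset ι) (x : α → P.carrier) {s : Finset α} {p : α}
    (hp : p ∈ s) (y : ι → P.carrier) :
    kap P (Function.update x p (∑ r ∈ I, y r)) s =
      ∑ r ∈ I, kap P (Function.update x p (y r)) s := by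
  obtain ⟨f, hf⟩ := exists_linearMap_kap P x hp
  simp only [← hf, map_sum]

/-- Free cumulants as multilinear maps. -/
noncomputable def cumMultilinear (n : ℕ) : MultilinearMap ℂ (fun _ : Fin n => P.carrier) ℂ where
  toFun := freeCumulant P n
  map_update_add' {inst} x p y z := by
    obtain ⟨f, hf⟩ := exists_linearMap_kap P x (Finset.mem_univ p)
    rw [Subsingleton.elim inst (instDecidableEqFin n)]
    simp only [← kap_univ, ← hf, map_add]
  map_update_smul' {inst} x p c y := by
    obtain ⟨f, hf⟩ := exists_linearMap_kap P x (Finset.mem_univ p)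
    rw [Subsingleton.elim inst (instDecidableEqFin n)]
    simp only [← kap_univ, ← hf, map_smul]

theorem freeCumulant_sum {n : ℕ} {ι : Type*} [Fintype ι] (y : Fin n → ι → P.carrier) :
    freeCumulant P n (fun t => ∑ r, y t r) =
      ∑ r : Fin n → ι, freeCumulant P n (fun t => y t (r t)) :=
  (cumMultilinear P n).map_sum y

end Cumulants

/-! ### Closed paths of matrix positions -/

section CyclicWords

variable {β : Type*}

/-- The word `(a₁, b₁), …, (aₙ, bₙ)` is a path from `c` to `d`: `c = a₁`, `b₁ = a₂`, …, `bₙ = d`. -/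
def Path : β → List (β × β) → β → Prop
  | c, [], d => c = d
  | c, x :: l, d => c = x.1 ∧ Path x.2 l d

/-- The word is a closed path. -/
def IsCyc (l : List (β × β)) : Prop := ∃ c, Path c l c

theorem path_append (c d : β) (l l' : List (β × β)) :
    Path c (l ++ l') d ↔ ∃ m, Path c l m ∧ Path m l' d := by
  induction l generalizing c with
  | nil => simp [Path]
  | cons x l ih => simp [Path, ih, and_assoc]

theorem Path.unique {c d d' : β} {l : List (β × β)} (h : Path c l d) (h' : Path c l d') :
    d = d' := by
  induction l generalizing c with
  | nil => exact h.symm.trans h'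
  | cons x l ih => exact ih h.2 h'.2

theorem path_ofFn (n : ℕ) (i j : Fin (n + 1) → β) (c d : β) :
    Path c (List.ofFn fun t => (i t, j t)) d ↔
      c = i 0 ∧ (∀ t : Fin n, j t.castSucc = i t.succ) ∧ j (Fin.last n) = d := by
  induction n generalizing c with
  | zero => simp [Path]
  | succ n ih =>
    rw [List.ofFn_succ, Path, ih (fun t => i t.succ) (fun t => j t.succ), Fin.forall_fin_succ]
    simp only [and_assoc, Fin.succ_castSucc, Fin.succ_last, Fin.castSucc_zero, Nat.succ_eq_add_one]

/-- Replaces the condition on the cyclic shift by one on paths, which can be cut and concatenated.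
-/
theorem isCyc_ofFn {n : ℕ} (hn : 1 ≤ n) (i j : Fin n → β) :
    IsCyc (List.ofFn fun t => (i t, j t)) ↔ ∀ t, j t = i (finRotate n t) := by
  obtain ⟨n, rfl⟩ := Nat.exists_eq_add_of_le' hn
  simp only [IsCyc, path_ofFn]
  constructor
  · rintro ⟨c, rfl, h1, h2⟩ t
    refine Fin.lastCases ?_ (fun t => ?_) t
    · rw [h2, finRotate_last]
    · rw [h1, finRotate_apply, Fin.coeSucc_eq_succ]
  · intro h
    refine ⟨i 0, rfl, fun t => ?_, ?_⟩
    · rw [h, finRotate_apply, Fin.coeSucc_eq_succ]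
    · rw [h, finRotate_last]

/-- Inserting the vertex `r` inside the letter `(i, j)` detaches the loop through `v₁`. It closes
exactly when `r` is the end of the path `v₁` starting at `j`, and what remains is then closed as
well. -/
theorem isCyc_split_right (u v₁ v₂ : List (β × β)) (i j r : β) :
    (IsCyc (u ++ (i, r) :: v₂) ∧ IsCyc ((r, j) :: v₁)) ↔
      IsCyc (u ++ (i, j) :: (v₁ ++ v₂)) ∧ Path j v₁ r := by
  simp only [IsCyc, path_append, Path]
  constructor
  · rintro ⟨⟨c, _, h1, rfl, h2⟩, _, rfl, h3⟩
    exact ⟨⟨c, _, h1, rfl, _, h3, h2⟩, h3⟩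
  · rintro ⟨⟨c, _, h1, rfl, m, h3, h2⟩, h4⟩
    obtain rfl := h3.unique h4
    exact ⟨⟨c, _, h1, rfl, h2⟩, _, rfl, h3⟩

theorem IsCyc.exists_path_right {u v₁ v₂ : List (β × β)} {i j : β}
    (h : IsCyc (u ++ (i, j) :: (v₁ ++ v₂))) : ∃ r, Path j v₁ r := by
  simp only [IsCyc, path_append, Path] at h
  obtain ⟨c, _, h1, rfl, m, h3, h2⟩ := h
  exact ⟨m, h3⟩

/-- Here the detached loop runs through `u₂` and returns to `r`. The last conjunct presents `r` as
the end of the path `u₁`, so that `Path.unique` gives its uniqueness. -/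
theorem isCyc_split_left (u₁ u₂ v : List (β × β)) (i j r : β) :
    (IsCyc (u₂ ++ [(i, r)]) ∧ IsCyc (u₁ ++ (r, j) :: v)) ↔
      IsCyc ((u₁ ++ u₂) ++ (i, j) :: v) ∧ Path r u₂ i ∧ ∃ c, Path c u₁ r ∧ Path j v c := by
  simp only [IsCyc, path_append, Path]
  constructor
  · rintro ⟨⟨c, _, h1, rfl, rfl⟩, d, _, h2, rfl, h3⟩
    exact ⟨⟨d, _, ⟨_, h2, h1⟩, rfl, h3⟩, h1, d, h2, h3⟩
  · rintro ⟨-, h1, d, h2, h3⟩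
    exact ⟨⟨r, _, h1, rfl, rfl⟩, d, _, h2, rfl, h3⟩

theorem IsCyc.existsUnique_path_left {u₁ u₂ v : List (β × β)} {i j : β}
    (h : IsCyc ((u₁ ++ u₂) ++ (i, j) :: v)) :
    ∃! r, Path r u₂ i ∧ ∃ c, Path c u₁ r ∧ Path j v c := by
  simp only [IsCyc, path_append, Path] at h
  obtain ⟨d, _, ⟨m, h2, h1⟩, rfl, h3⟩ := h
  refine ⟨m, ⟨h1, d, h2, h3⟩, ?_⟩
  rintro r ⟨-, c, h4, h5⟩
  obtain rfl := h3.unique h5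
  exact h4.unique h2

/-! ### Splitting one letter of a closed path -/

section Split

variable {α : Type*} [LinearOrder α]

/-- The labels after splitting the letter at `p` into two letters at `p` and at `q`. -/
def splitLabel (f : α → β × β) (p q : α) (r : β) : α → β × β :=
  Function.update (Function.update f q (r, (f p).2)) p ((f p).1, r)

theorem splitLabel_left (f : α → β × β) (p q : α) (r : β) :
    splitLabel f p q r p = ((f p).1, r) := Function.update_self _ _ _

theorem splitLabel_right (f : α → β × β) {p q : α} (h : p < q) (r : β) :
    splitLabel f p q r q = (r, (f p).2) := by
  rw [splitLabel, Function.update_of_ne h.ne', Function.update_self]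

theorem map_splitLabel (f : α → β × β) (p q : α) (r : β) (V : Finset α) (hp : p ∉ V)
    (hq : q ∉ V) : V.sort.map (splitLabel f p q r) = V.sort.map f := by
  refine List.map_congr_left fun t ht => ?_
  rw [Finset.mem_sort] at ht
  rw [splitLabel, Function.update_of_ne (fun e : t = p => hp (e ▸ ht)),
    Function.update_of_ne (fun e : t = q => hq (e ▸ ht))]

theorem isCyc_insert (f : α → β × β) {V : Finset α} {p q : α} (hpq : p < q) (hp : p ∈ V)
    (hq : q ∉ V) (hadj : ∀ t ∈ V, ¬ (p < t ∧ t < q)) (r : β) :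
    IsCyc ((insert q V).sort.map (splitLabel f p q r)) ↔ IsCyc (V.sort.map f) := by
  rw [sort_insert_of_adjacent hpq hp hq hadj, sort_eq_filter hp]
  simp only [List.map_append, List.map_cons,
    splitLabel_left, splitLabel_right f hpq]
  rw [map_splitLabel _ _ _ _ _ (by simp) (by simp [hq]),
    map_splitLabel _ _ _ _ _ (by simp) (by simp [hq])]
  simp [IsCyc, path_append, Path]

/-- Because `A` and its complement do not cross, one of them is a contiguous stretch of the word of
`V`, ending or starting at the split letter. It is a loop cut off from the path, and `C r` says that
`r` is the vertex where it closes. -/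
theorem isCyc_splits (f : α → β × β) {V A : Finset α} {p q : α} (hpq : p < q)
    (hq : q ∉ V) (hadj : ∀ t ∈ V, ¬ (p < t ∧ t < q)) (hA : A ∈ splits p q V) :
    ∃ C : β → Prop, (IsCyc (V.sort.map f) → ∃! r, C r) ∧ ∀ r,
      (IsCyc (A.sort.map (splitLabel f p q r)) ∧
        IsCyc ((insert q V \ A).sort.map (splitLabel f p q r))) ↔
      (IsCyc (V.sort.map f) ∧ C r) := by
  obtain ⟨hAV, hpA, hN⟩ := mem_splits.1 hA
  have hqA : q ∉ A := fun h => hq (hAV h)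
  have hqB : q ∈ insert q V \ A := Finset.mem_sdiff.2 ⟨Finset.mem_insert_self _ _, hqA⟩
  have hVB : ∀ t, t ∈ insert q V \ A ↔ (t = q ∨ t ∈ V) ∧ t ∉ A := by simp
  have hpB : p ∉ insert q V \ A := fun h => ((hVB p).1 h).2 hpA
  set B := insert q V \ A with hB
  have hne : ∀ {t}, t ∈ V → t ≠ q := fun ht e => hq (e ▸ ht)
  have hgt : ∀ {t}, t ∈ V → p < t → q < t := fun ht h =>
    lt_of_le_of_ne (not_lt.1 fun h' => hadj _ ht ⟨h, h'⟩) (hne ht).symm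
  have hBV : ∀ {t}, t ∈ B → t ≠ q → t ∈ V := fun ht h => ((hVB _).1 ht).1.resolve_left h
  have hBp : ∀ {t}, t ∈ B → t < q → t < p := fun ht h => by
    have h1 := hBV ht h.ne
    refine lt_of_le_of_ne (not_lt.1 fun h' => hadj _ h1 ⟨h', h⟩) ?_
    rintro rfl
    exact hpB ht
  rw [sort_eq_filter hpA, sort_eq_filter (hAV hpA), sort_eq_filter hqB]
  simp only [List.map_append, List.map_cons, splitLabel_left, splitLabel_right f hpq]
  have m1 : ∀ r, (A.filter (· < p)).sort.map (splitLabel f p q r) =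
      (A.filter (· < p)).sort.map f := fun r => map_splitLabel _ _ _ _ _ (by simp) (by simp [hqA])
  have m2 : ∀ r, (A.filter (p < ·)).sort.map (splitLabel f p q r) =
      (A.filter (p < ·)).sort.map f := fun r => map_splitLabel _ _ _ _ _ (by simp) (by simp [hqA])
  have m3 : ∀ r, (B.filter (· < q)).sort.map (splitLabel f p q r) =
      (B.filter (· < q)).sort.map f := fun r => map_splitLabel _ _ _ _ _ (by simp [hpB]) (by simp)
  have m4 : ∀ r, (B.filter (q < ·)).sort.map (splitLabel f p q r) =
      (B.filter (q < ·)).sort.map f := fun r => map_splitLabel _ _ _ _ _ (by simp [hpB]) (by simp)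
  simp only [m1, m2, m3, m4]
  by_cases hcase : ∃ b ∈ B, b < q
  -- `B` has points to the left of `p`: then `A` has none to the right of `p`, and to the left all
  -- of `B` precedes `A`. The loop is the one of `A`.
  · obtain ⟨b₀, hb₀, hb₀q⟩ := hcase
    have hb₀p : b₀ < p := hBp hb₀ hb₀q
    have hA' : A.filter (p < ·) = ∅ := by
      refine Finset.filter_eq_empty_iff.2 fun t ht hpt => ?_
      exact hN.2 ⟨b₀, p, q, t, hb₀p, hpq, hgt (hAV ht) hpt, hb₀, hqB, hpA, ht⟩
    have hV1 : V.filter (· < p) = B.filter (· < q) ∪ A.filter (· < p) := by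
      ext t
      simp only [Finset.mem_union, Finset.mem_filter]
      constructor
      · rintro ⟨h1, h2⟩
        by_cases h : t ∈ A
        · exact Or.inr ⟨h, h2⟩
        · exact Or.inl ⟨(hVB t).2 ⟨Or.inr h1, h⟩, h2.trans hpq⟩
      · rintro (⟨h1, h2⟩ | ⟨h1, h2⟩)
        · exact ⟨hBV h1 h2.ne, hBp h1 h2⟩
        · exact ⟨hAV h1, h2⟩
    have hV2 : V.filter (p < ·) = B.filter (q < ·) := by
      ext t
      simp only [Finset.mem_filter]
      constructor
      · rintro ⟨h1, h2⟩
        refine ⟨(hVB t).2 ⟨Or.inr h1, fun h => ?_⟩, hgt h1 h2⟩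
        exact Finset.filter_eq_empty_iff.1 hA' h h2
      · rintro ⟨h1, h2⟩
        exact ⟨hBV h1 h2.ne', hpq.trans h2⟩
    rw [hA', hV1, hV2, sort_union]
    · simp only [List.map_append, Finset.sort_empty, List.map_nil]
      exact ⟨_, fun h => h.existsUnique_path_left,
        fun r => isCyc_split_left _ _ _ _ _ r⟩
    · intro b hb a ha
      rw [Finset.mem_filter] at ha hb
      by_contra hab
      have hab : a < b := lt_of_le_of_ne (not_lt.1 hab) (by
        rintro rfl
        exact ((hVB a).1 hb.1).2 ha.1)
      exact hN.1 ⟨a, b, p, q, hab, hBp hb.1 hb.2, hpq, ha.1, hpA, hb.1, hqB⟩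
  -- `B` starts at `q`: to the right of `p` all of `B` precedes `A`, and the loop is the one of `B`.
  · push Not at hcase
    have hB' : B.filter (· < q) = ∅ :=
      Finset.filter_eq_empty_iff.2 fun t ht => (hcase t ht).not_gt
    have hV1 : V.filter (· < p) = A.filter (· < p) := by
      ext t
      simp only [Finset.mem_filter]
      constructor
      · rintro ⟨h1, h2⟩
        refine ⟨?_, h2⟩
        by_contra h
        exact (hcase t ((hVB t).2 ⟨Or.inr h1, h⟩)).not_gt (h2.trans hpq)
      · rintro ⟨h1, h2⟩
        exact ⟨hAV h1, h2⟩
    have hV2 : V.filter (p < ·) = B.filter (q < ·) ∪ A.filter (p < ·) := by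
      ext t
      simp only [Finset.mem_union, Finset.mem_filter]
      constructor
      · rintro ⟨h1, h2⟩
        by_cases h : t ∈ A
        · exact Or.inr ⟨h, h2⟩
        · exact Or.inl ⟨(hVB t).2 ⟨Or.inr h1, h⟩, hgt h1 h2⟩
      · rintro (⟨h1, h2⟩ | ⟨h1, h2⟩)
        · exact ⟨hBV h1 h2.ne', hpq.trans h2⟩
        · exact ⟨hAV h1, h2⟩
    rw [hB', hV1, hV2, sort_union]
    · simp only [List.map_append, Finset.sort_empty, List.map_nil, List.nil_append]
      refine ⟨_, fun h => ?_, fun r => isCyc_split_right _ _ _ _ _ r⟩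
      obtain ⟨r, hr⟩ := h.exists_path_right
      exact ⟨r, hr, fun r' h' => h'.unique hr⟩
    · intro b hb a ha
      rw [Finset.mem_filter] at ha hb
      by_contra hab
      have hab : a < b := lt_of_le_of_ne (not_lt.1 hab) (by
        rintro rfl
        exact ((hVB a).1 hb.1).2 ha.1)
      exact hN.1 ⟨p, q, a, b, hpq, hgt (hAV ha.1) ha.2, hab, hpA, ha.1, hqB, hb.1⟩

end Split

end CyclicWords

/-! ### Cumulants of entries and traces of powers -/

section TracesOfPowers

open scoped Classical

/-- Positions are indexed by rationals so that there is always room for a new point directly after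
`p`, without renumbering the others. -/
theorem exists_adjacent (s : Finset ℚ) (p : ℚ) :
    ∃ q, p < q ∧ q ∉ s ∧ ∀ t ∈ s, ¬ (p < t ∧ t < q) := by
  have h : ∀ᶠ q in 𝓝[>] p, ∀ t ∈ s, p < t → q < t := by
    refine (Finset.eventually_all s).2 fun t _ => ?_
    by_cases hpt : p < t
    · filter_upwards [Ioo_mem_nhdsGT hpt] with q hq _ using hq.2
    · exact Eventually.of_forall fun q h => absurd h hpt
  obtain ⟨q, hq, hpq⟩ := (h.and self_mem_nhdsWithin).exists
  exact ⟨q, hpq, fun h => lt_irrefl q (hq q h hpq), fun t ht h => (hq t ht h.1).asymm h.2⟩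

variable {P : NCProbSpace.{u}} {a : P.carrier} {Q : NCProbSpace.{v}} {N : ℕ}
  {A : Matrix (Fin N) (Fin N) Q.carrier}

theorem IsQuantumMatrix.kap_entries_one (hA : IsQuantumMatrix P a Q N A) (f : ℚ → Fin N × Fin N)
    (s : Finset ℚ) (hs : s.Nonempty) :
    kap Q (fun t => A (f t).1 (f t).2) s =
      (if IsCyc (s.sort.map f) then (N : ℂ) ^ ((1 : ℤ) - s.card) else 0) *
        kap P (fun _ => a) s := by
  have hcard : 1 ≤ s.card := hs.card_pos
  rw [kap_eq_freeCumulant Q _ s rfl, kap_eq_freeCumulant P _ s rfl,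
    ← ofFn_orderEmbOfFin f s rfl]
  have hiff := isCyc_ofFn hcard (fun t => (f (s.orderEmbOfFin rfl t)).1)
    (fun t => (f (s.orderEmbOfFin rfl t)).2)
  simp only [Prod.mk.eta] at hiff
  rw [hiff]
  split_ifs with h
  · simp only [h]
    exact hA.cyclic _ hcard _
  · rw [zero_mul]
    exact hA.noncyclic _ hcard (fun t => (f (s.orderEmbOfFin rfl t)).1)
      (fun t => (f (s.orderEmbOfFin rfl t)).2) (not_forall.1 h)

theorem sum_ite_mul_ite {N : ℕ} {c d : ℂ} {X Y C : Fin N → Prop} {Z : Prop}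
    (hC : Z → ∃! r, C r) (h : ∀ r, X r ∧ Y r ↔ Z ∧ C r) :
    ∑ r, (if X r then c else 0) * (if Y r then d else 0) = if Z then c * d else 0 := by
  have : ∀ r, (if X r then c else 0) * (if Y r then d else 0) = if Z ∧ C r then c * d else 0 := by
    intro r
    rw [ite_zero_mul_ite_zero]
    exact if_congr (h r) rfl rfl
  simp only [this]
  by_cases hZ : Z
  · obtain ⟨r, hr, hu⟩ := hC hZ
    rw [Finset.sum_eq_single r]
    · simp [hZ, hr]
    · intro r' _ hne
      exact if_neg fun h' => hne (hu r' h'.2)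
    · simp
  · simp [hZ]

/-- The free cumulants of the entries of the powers of a quantum random matrix. -/
theorem IsQuantumMatrix.kap_entries (hA : IsQuantumMatrix P a Q N A) (hN : 1 ≤ N) (m : ℕ)
    (k : ℚ → ℕ) (f : ℚ → Fin N × Fin N) (s : Finset ℚ) (hs : s.Nonempty)
    (hk : ∀ t ∈ s, 1 ≤ k t) (hm : ∑ t ∈ s, (k t - 1) ≤ m) :
    kap Q (fun t => (A ^ k t) (f t).1 (f t).2) s =
      (if IsCyc (s.sort.map f) then (N : ℂ) ^ ((1 : ℤ) - s.card) else 0) *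
        kap P (fun t => a ^ k t) s := by
  induction m generalizing k f s with
  | zero =>
    have h1 : ∀ t ∈ s, k t = 1 := fun t ht => by
      have := Finset.sum_eq_zero_iff.1 (Nat.le_zero.1 hm) t ht
      have := hk t ht
      omega
    rw [kap_congr (y := fun t => A (f t).1 (f t).2) fun t ht => by rw [h1 t ht, pow_one],
      kap_congr (y := fun _ => a) fun t ht => by rw [h1 t ht, pow_one]]
    exact hA.kap_entries_one f s hs
  | succ m ih =>
    by_cases hall : ∀ t ∈ s, k t = 1
    · exact ih k f s hs hk (by
        rw [Finset.sum_eq_zero fun t ht => by rw [hall t ht, Nat.sub_self]]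
        exact Nat.zero_le _)
    push Not at hall
    obtain ⟨p, hp, hkp⟩ := hall
    have hkp : 2 ≤ k p := by
      have := hk p hp
      omega
    obtain ⟨q, hpq, hq, hadj⟩ := exists_adjacent s p
    have hqs : ∀ {t}, t ∈ s → t ≠ q := fun ht e => hq (e ▸ ht)
    -- The power at `p` is factored as a first power at `p` times the remaining power at `q`. The
    -- exponents minus one then sum to one less.
    set k' : ℚ → ℕ := Function.update (Function.update k q (k p - 1)) p 1 with hk'
    have hk'p : k' p = 1 := Function.update_self _ _ _
    have hk'q : k' q = k p - 1 := by
      rw [hk', Function.update_of_ne hpq.ne', Function.update_self]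
    have hk't : ∀ t ∈ s, t ≠ p → k' t = k t := fun t ht hne => by
      rw [hk', Function.update_of_ne hne, Function.update_of_ne (hqs ht)]
    have hk1 : ∀ t ∈ insert q s, 1 ≤ k' t := by
      intro t ht
      rcases Finset.mem_insert.1 ht with rfl | ht
      · omega
      · by_cases h : t = p
        · rw [h, hk'p]
        · rw [hk't t ht h]
          exact hk t ht
    have hsum : ∑ t ∈ insert q s, (k' t - 1) ≤ m := by
      rw [Finset.sum_insert hq, ← Finset.add_sum_erase _ _ hp, hk'p, hk'q]
      rw [← Finset.add_sum_erase _ _ hp] at hm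
      rw [Finset.sum_congr rfl fun t ht => by
        rw [hk't t (Finset.mem_of_mem_erase ht) (Finset.ne_of_mem_erase ht)]]
      omega
    -- The induction bound is an inequality, so it passes to the blocks `V` of the split terms.
    have ih' : ∀ (r : Fin N) (V : Finset ℚ), V ⊆ insert q s → V.Nonempty →
        kap Q (fun t => (A ^ k' t) (splitLabel f p q r t).1 (splitLabel f p q r t).2) V =
        (if IsCyc (V.sort.map (splitLabel f p q r)) then (N : ℂ) ^ ((1 : ℤ) - V.card) else 0) *
          kap P (fun t => a ^ k' t) V := fun r V hV hne =>
      ih k' _ V hne (fun t ht => hk1 t (hV ht))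
        ((Finset.sum_le_sum_of_subset hV).trans hsum)
    have hright : kap P (fun t => a ^ k t) s = kap P (fun t => a ^ k' t) (insert q s) +
        ∑ V ∈ splits p q s, kap P (fun t => a ^ k' t) V *
          kap P (fun t => a ^ k' t) (insert q s \ V) := by
      rw [← kap_update_mul P _ hpq hp hq hadj]
      refine kap_congr fun t ht => ?_
      by_cases h : t = p
      · rw [h, Function.update_self, hk'p, hk'q, ← pow_add]
        congr 1
        omega
      · rw [Function.update_of_ne h, hk't t ht h]
    have hleft : kap Q (fun t => (A ^ k t) (f t).1 (f t).2) s = ∑ r, (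
        kap Q (fun t => (A ^ k' t) (splitLabel f p q r t).1 (splitLabel f p q r t).2)
          (insert q s) +
        ∑ V ∈ splits p q s,
          kap Q (fun t => (A ^ k' t) (splitLabel f p q r t).1 (splitLabel f p q r t).2) V *
          kap Q (fun t => (A ^ k' t) (splitLabel f p q r t).1 (splitLabel f p q r t).2)
            (insert q s \ V)) := by
      rw [kap_congr (y := Function.update (fun t => (A ^ k t) (f t).1 (f t).2) p
        (∑ r, A (f p).1 r * (A ^ (k p - 1)) r (f p).2)), kap_update_sum Q _ _ hp]
      · refine Finset.sum_congr rfl fun r _ => ?_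
        rw [← kap_update_mul Q _ hpq hp hq hadj]
        refine kap_congr fun t ht => ?_
        by_cases h : t = p
        · rw [h, Function.update_self, Function.update_self, hk'p, hk'q, splitLabel_left,
            splitLabel_right f hpq, pow_one]
        · rw [Function.update_of_ne h, Function.update_of_ne h, hk't t ht h, splitLabel,
            Function.update_of_ne h, Function.update_of_ne (hqs ht)]
      · intro t _
        by_cases h : t = p
        · rw [h, Function.update_self, ← Matrix.mul_apply, ← pow_succ',
            Nat.sub_add_cancel (by omega)]
        · rw [Function.update_of_ne h]
    have hNne : (N : ℂ) ≠ 0 := by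
      exact_mod_cast (by omega : N ≠ 0)
    rw [hleft, hright, Finset.sum_add_distrib, Finset.sum_comm, mul_add, Finset.mul_sum]
    congr 1
    -- All $N$ values of $r$ contribute equally; the factor $N$ compensates for the additional point
    -- `q`.
    · rw [Finset.sum_congr rfl fun r _ => by
        rw [ih' r _ subset_rfl (Finset.insert_nonempty _ _), isCyc_insert f hpq hp hq hadj r]]
      rw [Finset.sum_const, Finset.card_univ, Fintype.card_fin, nsmul_eq_mul, ← mul_assoc,
        Finset.card_insert_of_notMem hq, mul_ite, mul_zero]
      congr 2
      rw [← zpow_one_add₀ hNne]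
      congr 1
      push_cast
      ring
    · refine Finset.sum_congr rfl fun V hV => ?_
      obtain ⟨hVs, hpV, -⟩ := mem_splits.1 hV
      have hVs' : V ⊆ insert q s := hVs.trans (Finset.subset_insert _ _)
      have hqW : q ∈ insert q s \ V :=
        Finset.mem_sdiff.2 ⟨Finset.mem_insert_self _ _, fun h => hq (hVs h)⟩
      obtain ⟨C, hC, hX⟩ := isCyc_splits f hpq hq hadj hV
      rw [Finset.sum_congr rfl fun r _ => by
        rw [ih' r V hVs' ⟨p, hpV⟩, ih' r _ Finset.sdiff_subset ⟨q, hqW⟩, mul_mul_mul_comm]]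
      -- Only one value of `r` contributes; the exponents add up correctly because the two blocks
      -- together have `s.card + 1` points.
      rw [← Finset.sum_mul, sum_ite_mul_ite hC hX, ← zpow_add₀ hNne]
      have hcard : (V.card : ℤ) + (insert q s \ V).card = s.card + 1 := by
        have h := Finset.card_sdiff_add_card_eq_card hVs'
        rw [Finset.card_insert_of_notMem hq] at h
        omega
      congr 3
      linarith

/-- The order embedding of `{0, …, n-1}` into the rational numbers. -/
def finToRat (n : ℕ) : Fin n ↪o ℚ where
  toFun t := (t : ℕ)
  inj' s t h := Fin.ext (Nat.cast_injective h)
  map_rel_iff' {s t} := by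
    show ((s : ℕ) : ℚ) ≤ ((t : ℕ) : ℚ) ↔ s ≤ t
    rw [Nat.cast_le, Fin.le_def]

theorem IsQuantumMatrix.freeCumulant_entries (hA : IsQuantumMatrix P a Q N A) (hN : 1 ≤ N)
    {n : ℕ} (hn : 1 ≤ n) (k : Fin n → ℕ) (hk : ∀ t, 1 ≤ k t) (f : Fin n → Fin N × Fin N) :
    freeCumulant Q n (fun t => (A ^ k t) (f t).1 (f t).2) =
      (if IsCyc (List.ofFn f) then (N : ℂ) ^ ((1 : ℤ) - n) else 0) *
        freeCumulant P n (fun t => a ^ k t) := by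
  have : Nonempty (Fin n) := ⟨⟨0, hn⟩⟩
  have hinv : ∀ t, Function.invFun (finToRat n) (finToRat n t) = t :=
    Function.leftInverse_invFun (finToRat n).injective
  set s := (Finset.univ : Finset (Fin n)).map (finToRat n).toEmbedding with hs
  have h := hA.kap_entries hN _ (fun t => k (Function.invFun (finToRat n) t))
    (fun t => f (Function.invFun (finToRat n) t)) s (Finset.univ_nonempty.map)
    (fun t _ => hk _) le_rfl
  rw [hs, kap_map, kap_map, kap_eq_freeCumulant Q _ _ (Finset.card_fin n),
    kap_eq_freeCumulant P _ _ (Finset.card_fin n), freeCumulant_univ, freeCumulant_univ] at h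
  rw [sort_map_orderEmb, List.map_map, Fin.sort_univ, Finset.card_map, Finset.card_fin,
    ← List.ofFn_eq_map] at h
  simpa only [Function.comp_def, hinv] using h

theorem path_diag {n : ℕ} (i : Fin n → Fin N) (c d : Fin N) :
    Path c (List.ofFn fun t => (i t, i t)) d ↔ c = d ∧ ∀ t, i t = c := by
  induction n generalizing c with
  | zero => simp [Path]
  | succ n ih =>
    have h := ih (c := i 0) fun t => i t.succ
    rw [List.ofFn_succ, Path, h, Fin.forall_fin_succ]
    constructor
    · rintro ⟨h1, h2, h3⟩
      exact ⟨h1.trans h2, h1.symm, fun t => (h3 t).trans h1.symm⟩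
    · rintro ⟨h1, h2, h3⟩
      exact ⟨h2.symm, h2.trans h1, fun t => (h3 t).trans h2.symm⟩

/-- The free cumulants of the traces of powers of a quantum random matrix. -/
theorem IsQuantumMatrix.freeCumulant_trace (hA : IsQuantumMatrix P a Q N A) (hN : 1 ≤ N)
    {n : ℕ} (hn : 1 ≤ n) (k : Fin n → ℕ) (hk : ∀ t, 1 ≤ k t) :
    freeCumulant Q n (fun t => (A ^ k t).trace) =
      (N : ℂ) ^ ((2 : ℤ) - n) * freeCumulant P n (fun t => a ^ k t) := by
  have : Nonempty (Fin n) := ⟨⟨0, hn⟩⟩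
  have hNne : (N : ℂ) ≠ 0 := by
    exact_mod_cast (by omega : N ≠ 0)
  simp only [Matrix.trace, Matrix.diag_apply]
  rw [freeCumulant_sum Q (fun t i => (A ^ k t) i i)]
  rw [Finset.sum_congr rfl fun i _ =>
    hA.freeCumulant_entries hN hn k hk (fun t => (i t, i t)), ← Finset.sum_mul]
  congr 1
  rw [← Finset.sum_filter, Finset.sum_const, nsmul_eq_mul]
  -- A path of diagonal positions never leaves its vertex, so the closed ones are the constant
  -- tuples.
  have hcard : (Finset.univ.filter fun i : Fin n → Fin N =>
      IsCyc (List.ofFn fun t => (i t, i t))) =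
      Finset.univ.map ⟨Function.const (Fin n), Function.const_injective⟩ := by
    ext i
    simp only [IsCyc, path_diag, Finset.mem_filter, Finset.mem_univ, true_and, Finset.mem_map,
      Function.Embedding.coeFn_mk]
    exact exists_congr fun c => ⟨fun h => (funext h).symm, fun h t => (congrFun h t).symm⟩
  rw [hcard, Finset.card_map, Finset.card_fin, ← zpow_one_add₀ hNne]
  congr 1
  ring

end TracesOfPowers

/-! ### Existence of variables with prescribed cumulants -/

section Existence

variable {ι : Type*}

/-- The moment of the word `l` for the prescribed free cumulants `c`. -/
noncomputable def modelMoment (c : List ι → ℂ) (l : List ι) : ℂ :=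
  ncSum (fun V => c (V.sort.map l.get)) Finset.univ

theorem modelMoment_ofFn (c : List ι → ℂ) {n : ℕ} (y : Fin n → ι) :
    modelMoment c (List.ofFn y) = ncSum (fun V => c (V.sort.map y)) Finset.univ := by
  have : ∀ (l : List ι) (h : l.length = n), modelMoment c l =
      ncSum (fun V : Finset (Fin n) => c (V.sort.map fun t => l.get (t.cast h.symm))) Finset.univ := by
    rintro l rfl
    rfl
  rw [this _ List.length_ofFn]
  simp

theorem modelMoment_sort {α : Type*} [LinearOrder α] (c : List ι → ℂ) (x : α → ι) (s : Finset α) :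
    modelMoment c (s.sort.map x) = ncSum (fun V => c (V.sort.map x)) s := by
  rw [← ofFn_orderEmbOfFin x s rfl, modelMoment_ofFn]
  conv_rhs => rw [← Finset.map_orderEmbOfFin_univ s rfl, ncSum_map]
  simp only [sort_map_orderEmb, List.map_map]
  rfl

/-- The free algebra with the functional whose free cumulants in the generators are `c`. -/
noncomputable def modelSpace {ι : Type} (c : List ι → ℂ) : NCProbSpace.{0} where
  carrier := MonoidAlgebra ℂ (FreeMonoid ι)
  φ := Finsupp.linearCombination ℂ (fun w : FreeMonoid ι => modelMoment c w.toList) ∘ₗ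
    (MonoidAlgebra.coeffLinearEquiv ℂ).toLinearMap
  map_one := by
    have : modelMoment c [] = 1 := by
      simp [modelMoment, Finset.univ_eq_empty, ncSum_empty]
    simp [MonoidAlgebra.one_def, MonoidAlgebra.coeffLinearEquiv, this]

/-- The generators of `modelSpace`. -/
noncomputable def modelGen {ι : Type} (c : List ι → ℂ) (i : ι) : (modelSpace c).carrier :=
  MonoidAlgebra.of ℂ (FreeMonoid ι) (FreeMonoid.of i)

theorem modelSpace_moment {ι : Type} (c : List ι → ℂ) (l : List ι) :
    (modelSpace c).φ (l.map (modelGen c)).prod = modelMoment c l := by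
  have : (l.map (modelGen c)).prod =
      (MonoidAlgebra.of ℂ (FreeMonoid ι) (FreeMonoid.ofList l) : (modelSpace c).carrier) := by
    induction l with
    | nil => exact (map_one (MonoidAlgebra.of ℂ (FreeMonoid ι))).symm
    | cons i l ih =>
      rw [List.map_cons, List.prod_cons, ih, FreeMonoid.ofList_cons]
      exact (map_mul (MonoidAlgebra.of ℂ (FreeMonoid ι)) _ _).symm
  rw [this]
  show Finsupp.linearCombination ℂ (fun w : FreeMonoid ι => modelMoment c w.toList)
    (MonoidAlgebra.coeffLinearEquiv ℂ (MonoidAlgebra.of ℂ (FreeMonoid ι) (FreeMonoid.ofList l))) = _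
  simp [MonoidAlgebra.coeffLinearEquiv]

/-- The moment of every subword is by construction the non-crossing sum of the weights `c`;
uniqueness of the weights identifies them with the cumulants. -/
theorem freeCumulant_modelGen {ι : Type} (c : List ι → ℂ) {n : ℕ} (hn : 1 ≤ n) (x : Fin n → ι) :
    freeCumulant (modelSpace c) n (fun t => modelGen c (x t)) = c (List.ofFn x) := by
  have : Nonempty (Fin n) := ⟨⟨0, hn⟩⟩
  have h := weight_eq_of_ncSum_eq (w := kap (modelSpace c) fun t => modelGen c (x t))
    (w' := fun V => c (V.sort.map x)) Finset.univ Finset.univ_nonempty fun t _ _ => by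
      rw [← moment_eq_ncSum, ← modelMoment_sort, ← modelSpace_moment, oprod, List.map_map]
      rfl
  rw [kap_univ] at h
  rw [h, Fin.sort_univ, ← List.ofFn_eq_map]

open scoped Classical in
theorem exists_isQuantumMatrix (P : NCProbSpace.{u}) (a : P.carrier) (N : ℕ) :
    ∃ (Q : NCProbSpace.{0}) (A : Matrix (Fin N) (Fin N) Q.carrier), IsQuantumMatrix P a Q N A := by
  -- No positivity is required of the functional, so the cumulants demanded of the entries may
  -- simply be prescribed.
  let c : List (Fin N × Fin N) → ℂ := fun l =>
    if IsCyc l then (N : ℂ) ^ ((1 : ℤ) - l.length) * freeCumulant P l.length (fun _ => a) else 0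
  refine ⟨modelSpace c, fun i j => modelGen c (i, j), fun n hn i => ?_, fun n hn i j h => ?_⟩
  · rw [freeCumulant_modelGen c hn (fun t => (i t, i (finRotate n t)))]
    simp only [c]
    rw [if_pos ((isCyc_ofFn hn _ _).2 fun _ => rfl), List.length_ofFn]
  · rw [freeCumulant_modelGen c hn (fun t => (i t, j t))]
    simp only [c]
    rw [if_neg]
    rw [isCyc_ofFn hn]
    exact not_forall.2 h

end Existence

/-! ### Cumulants of order one and two -/

section SecondOrder

theorem ncSum_singleton {α : Type*} [LinearOrder α] (w : Finset α → ℂ) (p : α) :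
    ncSum w {p} = w {p} := by
  rw [ncSum_eq_add w (Finset.mem_singleton_self p), Finset.sum_eq_zero, add_zero]
  intro V hV
  obtain ⟨h1, h2⟩ := mem_erase_filter.1 hV
  rw [Finset.ssubset_singleton_iff.1 h1] at h2
  simp at h2

theorem ncSum_pair {α : Type*} [LinearOrder α] (w : Finset α → ℂ) {p q : α} (h : p ≠ q) :
    ncSum w {p, q} = w {p, q} + w {p} * w {q} := by
  rw [ncSum_eq_add w (Finset.mem_insert_self p {q})]
  congr 1
  have hs : ({p, q} : Finset α) \ {p} = {q} := by
    ext t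
    simp only [Finset.mem_sdiff, Finset.mem_insert, Finset.mem_singleton]
    constructor
    · tauto
    · rintro rfl
      exact ⟨Or.inr rfl, h.symm⟩
  have hN : NonCr {p} {q} := by
    constructor <;>
    · rintro ⟨i, j, k, l, h1, h2, h3, h4, h5, -, -⟩
      rw [Finset.mem_singleton] at h4 h5
      subst h4 h5
      exact (h1.trans h2).false
  rw [Finset.sum_eq_single {p}]
  · rw [hs, ncSum_singleton, restr, if_pos hN]
  · intro V hV hne
    obtain ⟨h1, h2⟩ := mem_erase_filter.1 hV
    refine absurd ?_ hne
    refine Finset.eq_singleton_iff_unique_mem.2 ⟨h2, fun t ht => ?_⟩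
    rcases Finset.mem_insert.1 (h1.1 ht) with e | e
    · exact e
    · rw [Finset.mem_singleton] at e
      subst e
      exact absurd (Finset.insert_subset h2 (Finset.singleton_subset_iff.2 ht)) h1.2
  · intro h'
    refine absurd (mem_erase_filter.2 ⟨?_, Finset.mem_singleton_self p⟩) h'
    exact Finset.ssubset_iff_of_subset (by simp) |>.2 ⟨q, by simp, by simpa using h.symm⟩

variable (P : NCProbSpace.{u})

theorem freeCumulant_one (x : P.carrier) : freeCumulant P 1 ![x] = P.φ x := by
  rw [← kap_univ, show (Finset.univ : Finset (Fin 1)) = {0} from rfl,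
    ← ncSum_singleton (kap P ![x]),
    ← moment_eq_ncSum]
  simp [oprod]

theorem freeCumulant_two (x y : P.carrier) :
    freeCumulant P 2 ![x, y] = P.φ (x * y) - P.φ x * P.φ y := by
  have h := ncSum_pair (kap P ![x, y]) (Fin.zero_ne_one (n := 0))
  rw [← ncSum_singleton (kap P ![x, y]) 0, ← ncSum_singleton (kap P ![x, y]) 1, ← moment_eq_ncSum, ← moment_eq_ncSum,
    ← moment_eq_ncSum, show ({0, 1} : Finset (Fin 2)) = Finset.univ from rfl, kap_univ] at h
  have e : oprod ![x, y] Finset.univ = x * y := by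
    rw [oprod, Fin.sort_univ]
    simp [List.finRange_succ]
  rw [e] at h
  simp only [oprod, Finset.sort_singleton, List.map_cons, List.map_nil, List.prod_singleton,
    Matrix.cons_val_zero, Matrix.cons_val_one] at h
  rw [h]
  ring

end SecondOrder

/-! ### Normalized variables with different fourth moments -/

section Examples

open scoped ENNReal

/-- The `*`-probability space of continuous functions on `ℝ`, with the expectation given by `μ`. -/
noncomputable def continuousSpace (μ : Measure ℝ) [IsProbabilityMeasure μ]
    (hμ : ∀ f : C(ℝ, ℂ), Integrable f μ) : StarProbSpace.{0} where
  carrier := C(ℝ, ℂ)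
  φ :=
    { toFun := fun f => ∫ x, f x ∂μ
      map_add' := fun f g => integral_add (hμ f) (hμ g)
      map_smul' := fun c f => integral_const_mul c f }
  map_one := by simp
  positive := fun f => by
    have : ∫ x, (star f * f) x ∂μ = ((∫ x, Complex.normSq (f x) ∂μ : ℝ) : ℂ) := by
      refine Eq.trans ?_ (integral_ofReal (𝕜 := ℂ))
      refine integral_congr_ae (Eventually.of_forall fun x => ?_)
      exact Complex.normSq_eq_conj_mul_self.symm
    show 0 ≤ (∫ x, (star f * f) x ∂μ).re ∧ (∫ x, (star f * f) x ∂μ).im = 0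
    rw [this]
    exact ⟨integral_nonneg fun x => Complex.normSq_nonneg _, Complex.ofReal_im _⟩

/-- The coordinate function. -/
noncomputable def coordinate (μ : Measure ℝ) [IsProbabilityMeasure μ]
    (hμ : ∀ f : C(ℝ, ℂ), Integrable f μ) : (continuousSpace μ hμ).carrier :=
  (⟨fun x => (x : ℂ), Complex.continuous_ofReal⟩ : C(ℝ, ℂ))

theorem continuousSpace_moment (μ : Measure ℝ) [IsProbabilityMeasure μ]
    (hμ : ∀ f : C(ℝ, ℂ), Integrable f μ) (m : ℕ) :
    (continuousSpace μ hμ).φ (coordinate μ hμ ^ m) = ((∫ x, x ^ m ∂μ : ℝ) : ℂ) := by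
  refine Eq.trans ?_ (integral_ofReal (𝕜 := ℂ))
  refine integral_congr_ae (Eventually.of_forall fun x => ?_)
  show ((⟨fun x => (x : ℂ), Complex.continuous_ofReal⟩ : C(ℝ, ℂ)) ^ m) x = _
  simp

theorem isSelfAdjoint_coordinate (μ : Measure ℝ) [IsProbabilityMeasure μ]
    (hμ : ∀ f : C(ℝ, ℂ), Integrable f μ) : IsSelfAdjoint (coordinate μ hμ) := by
  refine ContinuousMap.ext fun x => ?_
  exact Complex.conj_ofReal x

/-- The mixture of the uniform distribution on `[-2, 2]` and of the symmetric distribution on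
`{-c, c}`, with weights `1 - w` and `w`. -/
noncomputable def mixture (c w : ℝ) : Measure ℝ :=
  ENNReal.ofReal ((1 - w) / 4) • volume.restrict (Set.Icc (-2) 2) +
    ENNReal.ofReal (w / 2) • (Measure.dirac c + Measure.dirac (-c))

variable {c w : ℝ}

theorem isProbabilityMeasure_mixture (hw : 0 ≤ w) (hw' : w < 1) :
    IsProbabilityMeasure (mixture c w) := by
  constructor
  simp only [mixture, Measure.add_apply, Measure.smul_apply, Measure.restrict_apply_univ,
    Real.volume_Icc, smul_eq_mul, measure_univ]
  rw [show (1 + 1 : ℝ≥0∞) = ENNReal.ofReal 2 by norm_num, ← ENNReal.ofReal_mul (by linarith),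
    ← ENNReal.ofReal_mul (by linarith), ← ENNReal.ofReal_add (by nlinarith) (by linarith)]
  rw [← ENNReal.ofReal_one]
  congr 1
  ring

theorem integrable_mixture {E : Type*} [NormedAddCommGroup E] {f : ℝ → E}
    (hf : Continuous f) : Integrable f (mixture c w) := by
  refine Integrable.add_measure ?_ ?_
  · exact (hf.continuousOn.integrableOn_compact isCompact_Icc).smul_measure ENNReal.ofReal_ne_top
  · exact (Integrable.add_measure (integrable_dirac (by finiteness))
      (integrable_dirac (by finiteness))).smul_measure ENNReal.ofReal_ne_top

theorem integral_mixture (hw : 0 ≤ w) (hw' : w < 1) {f : ℝ → ℝ} (hf : Continuous f) :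
    ∫ x, f x ∂(mixture c w) =
      (1 - w) / 4 * (∫ x in (-2 : ℝ)..2, f x) + w / 2 * (f c + f (-c)) := by
  have h := integrable_mixture (c := c) (w := w) hf
  rw [mixture] at h ⊢
  rw [integral_add_measure h.left_of_add_measure h.right_of_add_measure, integral_smul_measure,
    integral_smul_measure, integral_add_measure (integrable_dirac (by finiteness))
      (integrable_dirac (by finiteness)), integral_dirac,
    integral_dirac, ENNReal.toReal_ofReal (by linarith), ENNReal.toReal_ofReal (by linarith),
    intervalIntegral.integral_of_le (by norm_num), integral_Icc_eq_integral_Ioc]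
  rfl

theorem integral_pow_mixture (hw : 0 ≤ w) (hw' : w < 1) (m : ℕ) :
    ∫ x, x ^ m ∂(mixture c w) = (1 - w) / 4 * ((2 ^ (m + 1) - (-2) ^ (m + 1)) / (m + 1)) +
      w / 2 * (c ^ m + (-c) ^ m) := by
  rw [integral_mixture hw hw' (by fun_prop), integral_pow]

theorem integral_sq_mixture (hw : 0 ≤ w) (hw' : w < 1) :
    ∫ x, x ^ 2 ∂(mixture c w) = (1 - w) * (4 / 3) + w * c ^ 2 := by
  rw [integral_pow_mixture hw hw']
  push_cast
  ring

/-- The uniform part has positive weight and already charges every neighbourhood of a point of the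
interval; the atoms add nothing outside it. -/
theorem support_mixture (hw' : w < 1) (hc : c ∈ Set.Icc (-2 : ℝ) 2) :
    (mixture c w).support = Set.Icc (-2) 2 := by
  have hc' : -c ∈ Set.Icc (-2 : ℝ) 2 := ⟨by linarith [hc.2], by linarith [hc.1]⟩
  refine Set.Subset.antisymm ?_ fun x hx => ?_
  · refine Measure.support_subset_of_isClosed isClosed_Icc ?_
    rw [mem_ae_iff, mixture]
    simp [hc, hc', measurableSet_Icc, Measure.restrict_apply]
  · rw [Measure.mem_support_iff_forall]
    intro U hU
    have hpos : 0 < volume (U ∩ Set.Icc (-2 : ℝ) 2) := by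
      obtain ⟨ε, hε, hball⟩ := Metric.mem_nhds_iff.1 hU
      have hsub : Set.Ioo (max (x - ε) (-2)) (min (x + ε) 2) ⊆ U ∩ Set.Icc (-2 : ℝ) 2 := by
        rintro y ⟨h1, h2⟩
        rw [max_lt_iff] at h1
        rw [lt_min_iff] at h2
        refine ⟨hball ?_, h1.2.le, h2.2.le⟩
        rw [Real.ball_eq_Ioo]
        exact ⟨h1.1, h2.1⟩
      refine lt_of_lt_of_le ?_ (measure_mono hsub)
      rw [Real.volume_Ioo, ENNReal.ofReal_pos, sub_pos, lt_min_iff, max_lt_iff, max_lt_iff]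
      exact ⟨⟨by linarith, by linarith [hx.1]⟩, by linarith [hx.2], by norm_num⟩
    have hle : ENNReal.ofReal ((1 - w) / 4) * volume (U ∩ Set.Icc (-2 : ℝ) 2) ≤
        mixture c w U := by
      rw [mixture, Measure.add_apply, Measure.smul_apply, smul_eq_mul]
      exact (mul_le_mul_right (Measure.le_restrict_apply _ _) _).trans le_self_add
    exact (ENNReal.mul_pos (ENNReal.ofReal_pos.2 (by linarith)).ne' hpos.ne').trans_le hle

/-- The mean vanishes by symmetry, and `hv` is the condition that the second moment be one. It
leaves a one-parameter family in which the fourth moment varies. -/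
theorem isNormalized_mixture (hw : 0 ≤ w) (hw' : w < 1) (hc : c ∈ Set.Icc (-2 : ℝ) 2)
    (hv : (1 - w) * (4 / 3) + w * c ^ 2 = 1) [IsProbabilityMeasure (mixture c w)] :
    IsNormalized (continuousSpace (mixture c w) fun f => integrable_mixture f.continuous)
      (coordinate (mixture c w) fun f => integrable_mixture f.continuous) := by
  refine ⟨isSelfAdjoint_coordinate _ _, ⟨_, ‹_›, support_mixture hw' hc,
    continuousSpace_moment _ _⟩, ?_, ?_⟩
  · rw [freeCumulant_one, ← pow_one (coordinate _ _), continuousSpace_moment,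
      integral_pow_mixture hw hw']
    norm_num
  · rw [freeCumulant_two, ← pow_two, continuousSpace_moment, ← pow_one (coordinate _ _),
      continuousSpace_moment, integral_sq_mixture hw hw', integral_pow_mixture hw hw', hv]
    norm_num

theorem freeCumulant_two_mixture (hw : 0 ≤ w) (hw' : w < 1)
    (hv : (1 - w) * (4 / 3) + w * c ^ 2 = 1) [IsProbabilityMeasure (mixture c w)] :
    freeCumulant (continuousSpace (mixture c w) fun f => integrable_mixture f.continuous).toNCProbSpace
      2 ![coordinate (mixture c w) (fun f => integrable_mixture f.continuous) ^ 2,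
        coordinate (mixture c w) (fun f => integrable_mixture f.continuous) ^ 2] =
      (((1 - w) * (16 / 5) + w * c ^ 4 - 1 : ℝ) : ℂ) := by
  rw [freeCumulant_two, ← pow_add, continuousSpace_moment, continuousSpace_moment,
    integral_sq_mixture hw hw', integral_pow_mixture hw hw', hv, Complex.ofReal_one, mul_one,
    ← Complex.ofReal_one, ← Complex.ofReal_sub]
  congr 1
  push_cast
  ring

/-- Two normalized random variables whose squares have different variances. -/
theorem exists_normalized_ne :
    ∃ (P P' : StarProbSpace.{0}) (a : P.carrier) (b : P'.carrier),
      IsNormalized P a ∧ IsNormalized P' b ∧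
      freeCumulant P.toNCProbSpace 2 ![a ^ 2, a ^ 2] ≠
        freeCumulant P'.toNCProbSpace 2 ![b ^ 2, b ^ 2] := by
  have h1 : IsProbabilityMeasure (mixture 0 (1 / 4)) :=
    isProbabilityMeasure_mixture (by norm_num) (by norm_num)
  have h2 : IsProbabilityMeasure (mixture (1 / 2) (4 / 13)) :=
    isProbabilityMeasure_mixture (by norm_num) (by norm_num)
  -- Two rational solutions of $(1-w)\tfrac43+wc^2=1$. The variances of the squares are $7/5$ and
  -- $321/260$.
  refine ⟨_, _, _, _, isNormalized_mixture (c := 0) (w := 1 / 4) (by norm_num) (by norm_num)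
    (by norm_num) (by norm_num), isNormalized_mixture (c := 1 / 2) (w := 4 / 13) (by norm_num)
    (by norm_num) (by norm_num) (by norm_num), ?_⟩
  rw [freeCumulant_two_mixture (by norm_num) (by norm_num) (by norm_num),
    freeCumulant_two_mixture (by norm_num) (by norm_num) (by norm_num)]
  norm_num [Complex.ofReal_inj, -Complex.ofReal_sub, -Complex.ofReal_add, -Complex.ofReal_mul]

end Examples

/-! ### Covariances, limits and the failure of universality -/

theorem IsQuantumMatrix.freeCumulant_two_trace {P : NCProbSpace.{u}} {a : P.carrier}
    {Q : NCProbSpace.{v}} {N : ℕ} {A : Matrix (Fin N) (Fin N) Q.carrier}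
    (hA : IsQuantumMatrix P a Q N A) (hN : 1 ≤ N) {p q : ℕ} (hp : 1 ≤ p) (hq : 1 ≤ q) :
    freeCumulant Q 2 ![(A ^ p).trace, (A ^ q).trace] = freeCumulant P 2 ![a ^ p, a ^ q] := by
  have h := hA.freeCumulant_trace (n := 2) hN (by norm_num) ![p, q] (by simp [Fin.forall_fin_two, hp, hq])
  have e1 : (fun t : Fin 2 => (A ^ (![p, q] : Fin 2 → ℕ) t).trace) = ![(A ^ p).trace, (A ^ q).trace] := by
    ext t
    fin_cases t <;> rfl
  have e2 : (fun t : Fin 2 => a ^ (![p, q] : Fin 2 → ℕ) t) = ![a ^ p, a ^ q] := by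
    ext t
    fin_cases t <;> rfl
  rw [e1, e2] at h
  simpa using h

theorem tendsto_natCast_zpow {n : ℕ} (hn : 3 ≤ n) :
    Tendsto (fun N : ℕ => (N : ℂ) ^ ((2 : ℤ) - n)) atTop (𝓝 0) := by
  obtain ⟨m, rfl⟩ := Nat.exists_eq_add_of_le hn
  -- This also holds at `N = 0`, where both sides are zero by convention.
  have h : ∀ N : ℕ, (N : ℂ) ^ ((2 : ℤ) - (3 + m : ℕ)) = ((N : ℂ)⁻¹) ^ (m + 1) := by
    intro N
    rw [inv_pow, ← zpow_natCast, ← zpow_neg]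
    congr 1
    push_cast
    ring
  simp only [h]
  simpa using (tendsto_inv_atTop_nhds_zero_nat (𝕜 := ℂ)).pow (m + 1)

theorem not_universalFluctuations : ¬ UniversalFluctuations := by
  rintro ⟨C, hC⟩
  obtain ⟨P, P', a, b, ha, hb, hne⟩ := exists_normalized_ne
  have key : ∀ (P : StarProbSpace.{0}) (a : P.carrier), IsNormalized P a →
      C 2 2 = freeCumulant P.toNCProbSpace 2 ![a ^ 2, a ^ 2] := by
    intro P a ha
    -- Existence of the matrices is needed here: without it the assumed universality could hold
    -- vacuously.
    choose Q A hA using exists_isQuantumMatrix P.toNCProbSpace a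
    refine tendsto_nhds_unique (hC P a ha Q A (fun N _ => hA N) 2 2 one_le_two one_le_two) ?_
    refine tendsto_const_nhds.congr' ?_
    filter_upwards [eventually_ge_atTop 1] with N hN
    exact ((hA N).freeCumulant_two_trace hN one_le_two one_le_two).symm
  exact hne ((key P a ha).symm.trans (key P' b hb))

end QuantumRandomMatrix

theorem mainTheorem2 :
    -- existence of the quantum random matrices
    (∀ (P : QuantumRandomMatrix.NCProbSpace.{u}) (a : P.carrier) (N : ℕ), 1 ≤ N →
      ∃ (Q : QuantumRandomMatrix.NCProbSpace.{0}) (A : Matrix (Fin N) (Fin N) Q.carrier),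
        QuantumRandomMatrix.IsQuantumMatrix P a Q N A) ∧
    -- the free cumulants of traces of powers
    (∀ (P : QuantumRandomMatrix.NCProbSpace.{u}) (a : P.carrier)
        (Q : QuantumRandomMatrix.NCProbSpace.{v}) (N : ℕ), 1 ≤ N →
      ∀ A : Matrix (Fin N) (Fin N) Q.carrier, QuantumRandomMatrix.IsQuantumMatrix P a Q N A →
      ∀ n : ℕ, 1 ≤ n → ∀ k : Fin n → ℕ, (∀ t, 1 ≤ k t) →
        QuantumRandomMatrix.freeCumulant Q n (fun t => (A ^ k t).trace) =
          (N : ℂ) ^ ((2 : ℤ) - n) * QuantumRandomMatrix.freeCumulant P n (fun t => a ^ k t)) ∧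
    -- the cumulants of order higher than two vanish in the limit
    (∀ (P : QuantumRandomMatrix.NCProbSpace.{u}) (a : P.carrier)
        (Q : ℕ → QuantumRandomMatrix.NCProbSpace.{v})
        (A : ∀ N, Matrix (Fin N) (Fin N) (Q N).carrier),
      (∀ N, 1 ≤ N → QuantumRandomMatrix.IsQuantumMatrix P a (Q N) N (A N)) →
      ∀ n : ℕ, 3 ≤ n → ∀ k : Fin n → ℕ, (∀ t, 1 ≤ k t) →
        Tendsto (fun N => QuantumRandomMatrix.freeCumulant (Q N) n (fun t => (A N ^ k t).trace))
          atTop (𝓝 0)) ∧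
    -- the covariances, for every `N`
    (∀ (P : QuantumRandomMatrix.NCProbSpace.{u}) (a : P.carrier)
        (Q : QuantumRandomMatrix.NCProbSpace.{v}) (N : ℕ), 1 ≤ N →
      ∀ A : Matrix (Fin N) (Fin N) Q.carrier, QuantumRandomMatrix.IsQuantumMatrix P a Q N A →
      ∀ p q : ℕ, 1 ≤ p → 1 ≤ q →
        QuantumRandomMatrix.freeCumulant Q 2 ![(A ^ p).trace, (A ^ q).trace] =
          QuantumRandomMatrix.freeCumulant P 2 ![a ^ p, a ^ q]) ∧
    -- the covariances depend on `a`, also for normalized `a`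
    (∃ (P P' : QuantumRandomMatrix.StarProbSpace.{0}) (a : P.carrier) (b : P'.carrier) (p q : ℕ),
      QuantumRandomMatrix.IsNormalized P a ∧ QuantumRandomMatrix.IsNormalized P' b ∧
      1 ≤ p ∧ 1 ≤ q ∧
      ∀ (Q Q' : QuantumRandomMatrix.NCProbSpace.{v}) (N : ℕ), 1 ≤ N →
        ∀ A B, QuantumRandomMatrix.IsQuantumMatrix P.toNCProbSpace a Q N A →
          QuantumRandomMatrix.IsQuantumMatrix P'.toNCProbSpace b Q' N B →
          QuantumRandomMatrix.freeCumulant Q 2 ![(A ^ p).trace, (A ^ q).trace] ≠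
            QuantumRandomMatrix.freeCumulant Q' 2 ![(B ^ p).trace, (B ^ q).trace]) ∧
    -- the fluctuations are not universal
    ¬ QuantumRandomMatrix.UniversalFluctuations := by
  refine ⟨fun P a N _ => QuantumRandomMatrix.exists_isQuantumMatrix P a N,
    fun P a Q N hN A hA n hn k hk => hA.freeCumulant_trace hN hn k hk, ?_,
    fun P a Q N hN A hA p q hp hq => hA.freeCumulant_two_trace hN hp hq, ?_,
    QuantumRandomMatrix.not_universalFluctuations⟩
  · intro P a Q A hA n hn k hk
    have h := (QuantumRandomMatrix.tendsto_natCast_zpow hn).mul_const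
      (QuantumRandomMatrix.freeCumulant P n fun t => a ^ k t)
    rw [zero_mul] at h
    refine h.congr' ?_
    -- The matrix of size `0` is unconstrained, so the identity is available only from `N = 1` on.
    filter_upwards [eventually_ge_atTop 1] with N hN
    exact ((hA N hN).freeCumulant_trace hN (by omega) k hk).symm
  · obtain ⟨P, P', a, b, ha, hb, hne⟩ := QuantumRandomMatrix.exists_normalized_ne
    refine ⟨P, P', a, b, 2, 2, ha, hb, one_le_two, one_le_two, fun Q Q' N hN A B hA hB => ?_⟩
    rwa [hA.freeCumulant_two_trace hN one_le_two one_le_two,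
      hB.freeCumulant_two_trace hN one_le_two one_le_two]
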